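/- Let $n\ge 2$, and let $h:[0,\infty)\to[0,\infty)$ be continuous and strictly increasing with $h(0)=0$. Put $H(t)=h(t)/t$ for $t>0$ (with $H(|\xi|)\xi:=0$ for $\xi=0$) and $F(t)=\int_0^t h(\tau)\,d\tau$. Assume that one of the following coercivity conditions holds, and let $X(D)$ denote the corresponding function space on a domain $D\subset\mathbb R^n$: (a) there are $p>1$ and $c,C>0$ with $c\,t^{p-1}<h(t)<C\,t^{p-1}$ for all $t>0$; then $X(D)=W^{1,p}(D)$; (b) $h(t)\to\infty$ as $t\to\infty$ and, with $F^*(t)=\int_0^t h^{-1}(\tau)\,d\tau$ the Legendre transform of $F$, there are $t_0,C_0>0$ such that $F(2t)\le C_0F(t)$ and $F^*(2t)\le C_0F^*(t)$ for all $t>t_0$; then $X(D)=W^{1,F}(D)$ is the Sobolev--Orlicz space of all $u$ with $u,|\nabla u|\in L^F(D)$, where $f\in L^F(D)$ means that $\int_D F(|f|/M)\,dx\le F(1)$ for some $M>0$. **Theorem (comparison principle).** Let $D\subset\mathbb R^n$ be a (not necessarily bounded) domain with $C^1$ boundary. Let $u\in X(D)$ be a weak solution of $\operatorname{div}(H(|\nabla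 u|)\nabla u)=0$ in $D$, i.e. $$\int_D H(|\nabla u|)\,\nabla u\cdot\nabla\varphi\,dx=0\qquad\text{for all }\varphi\in C_c^\infty(D),$$ and let $v\in X(D)$ be a weak sub-solution, i.e. $$\int_D H(|\nabla v|)\,\nabla v\cdot\nabla\varphi\,dx\le 0\qquad\text{for all }\varphi\in C_c^\infty(D),\ \varphi\ge 0.$$ If $v\le u$ on $\partial D$ in the sense of the trace operator (that is, the traces satisfy $Tv\le Tu$ almost everywhere on $\partial D$ with respect to the $(n-1)$-dimensional surface measure), then $v\le u$ almost everywhere in $D$. -/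

import Mathlib

open Set Filter Topology MeasureTheory
open scoped ContDiff ENNReal

noncomputable section

namespace HComparison

/-- Standing assumptions on the profile `h : [0,∞) → [0,∞)`: it is continuous, (strictly)
increasing and vanishes at `0`. Values of `h` at negative arguments play no role. -/
structure IsProfile (h : ℝ → ℝ) : Prop where
  continuousOn : ContinuousOn h (Ici 0)
  strictMonoOn : StrictMonoOn h (Ici 0)
  map_zero : h 0 = 0

/-- The energy density `F(t) = ∫₀ᵗ h(τ) dτ`. -/
def energy (h : ℝ → ℝ) (t : ℝ) : ℝ := ∫ τ in (0 : ℝ)..t, h τ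

/-- The inverse function `g` of `h : [0,∞) → [0,∞)`. -/
def inverseProfile (h : ℝ → ℝ) : ℝ → ℝ := Function.invFunOn h (Ici 0)

/-- The Legendre transform `F*(t) = ∫₀ᵗ g(τ) dτ` of `F`, where `g = h⁻¹`. -/
def dualEnergy (h : ℝ → ℝ) (t : ℝ) : ℝ := ∫ τ in (0 : ℝ)..t, inverseProfile h τ

/-- Power growth: `c t^(p-1) < h(t) < C t^(p-1)` for all `t > 0`, with constants `c, C > 0`. -/
def HasPowerGrowth (h : ℝ → ℝ) (p : ℝ) : Prop :=
  ∃ c > 0, ∃ C > 0, ∀ t > 0, c * t ^ (p - 1) < h t ∧ h t < C * t ^ (p - 1)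

/-- The `Δ₂` condition for large arguments. -/
def Delta2 (Φ : ℝ → ℝ) : Prop :=
  ∃ t₀ > 0, ∃ C₀ > 0, ∀ t > t₀, Φ (2 * t) ≤ C₀ * Φ t

/-- The Orlicz coercivity condition: `h` is unbounded (so that its inverse `g` is defined on
all of `[0,∞)`), and both `F` and its Legendre transform `F*` satisfy `Δ₂`. -/
structure IsOrliczCoercive (h : ℝ → ℝ) : Prop where
  tendsto : Tendsto h atTop atTop
  delta2_energy : Delta2 (energy h)
  delta2_dualEnergy : Delta2 (dualEnergy h)

variable {n : ℕ}

/-- `φ ∈ C_c^∞(D)`. -/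
structure IsTestFunction (D : Set (EuclideanSpace ℝ (Fin n)))
    (φ : EuclideanSpace ℝ (Fin n) → ℝ) : Prop where
  contDiff : ContDiff ℝ ∞ φ
  hasCompactSupport : HasCompactSupport φ
  tsupport_subset : tsupport φ ⊆ D

/-- `G` is the weak (distributional) gradient of `u` in the open set `D`. -/
structure HasWeakGradient (D : Set (EuclideanSpace ℝ (Fin n)))
    (u : EuclideanSpace ℝ (Fin n) → ℝ)
    (G : EuclideanSpace ℝ (Fin n) → EuclideanSpace ℝ (Fin n)) : Prop where
  locallyIntegrableOn : LocallyIntegrableOn u D volume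
  locallyIntegrableOn_grad : LocallyIntegrableOn G D volume
  integral_eq : ∀ φ, IsTestFunction D φ →
    ∫ x in D, u x • gradient φ x = -∫ x in D, φ x • G x

/-- `u ∈ W^{1,p}(D)`, with weak gradient `G`. -/
structure MemSobolev (p : ℝ) (D : Set (EuclideanSpace ℝ (Fin n)))
    (u : EuclideanSpace ℝ (Fin n) → ℝ)
    (G : EuclideanSpace ℝ (Fin n) → EuclideanSpace ℝ (Fin n)) : Prop where
  hasWeakGradient : HasWeakGradient D u G
  memLp : MemLp u (ENNReal.ofReal p) (volume.restrict D)
  memLp_grad : MemLp G (ENNReal.ofReal p) (volume.restrict D)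

/-- `|f| ∈ L^Φ(D)`: the set of all `M > 0` with `∫_D Φ(|f|/M) dx ≤ Φ(1)`, whose minimum is the
Orlicz norm, is non-empty. -/
def MemOrlicz {V : Type*} [NormedAddCommGroup V] (Φ : ℝ → ℝ)
    (D : Set (EuclideanSpace ℝ (Fin n))) (f : EuclideanSpace ℝ (Fin n) → V) : Prop :=
  AEStronglyMeasurable f (volume.restrict D) ∧
    ∃ M > 0, ∫⁻ x in D, ENNReal.ofReal (Φ (‖f x‖ / M)) ≤ ENNReal.ofReal (Φ 1)

/-- `u ∈ W^{1,Φ}(D)`, with weak gradient `G`. -/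
structure MemSobolevOrlicz (Φ : ℝ → ℝ) (D : Set (EuclideanSpace ℝ (Fin n)))
    (u : EuclideanSpace ℝ (Fin n) → ℝ)
    (G : EuclideanSpace ℝ (Fin n) → EuclideanSpace ℝ (Fin n)) : Prop where
  hasWeakGradient : HasWeakGradient D u G
  memOrlicz : MemOrlicz Φ D u
  memOrlicz_grad : MemOrlicz Φ D G

/-- The field `ξ ↦ H(|ξ|) ξ`, where `H(t) = h(t) / t`; it is `0` at `ξ = 0`. -/
def flux (h : ℝ → ℝ) (ξ : EuclideanSpace ℝ (Fin n)) : EuclideanSpace ℝ (Fin n) :=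
  (h ‖ξ‖ / ‖ξ‖) • ξ

/-- A function with weak gradient `G` is a weak solution of `div(H(|∇u|)∇u) = 0` in `D`. -/
def IsWeakSolution (h : ℝ → ℝ) (D : Set (EuclideanSpace ℝ (Fin n)))
    (G : EuclideanSpace ℝ (Fin n) → EuclideanSpace ℝ (Fin n)) : Prop :=
  ∀ φ, IsTestFunction D φ → ∫ x in D, inner ℝ (flux h (G x)) (gradient φ x) = 0

/-- A function with weak gradient `G` is a weak sub-solution, `div(H(|∇v|)∇v) ≥ 0` in `D`. -/
def IsWeakSubsolution (h : ℝ → ℝ) (D : Set (EuclideanSpace ℝ (Fin n)))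
    (G : EuclideanSpace ℝ (Fin n) → EuclideanSpace ℝ (Fin n)) : Prop :=
  ∀ φ, IsTestFunction D φ → (∀ x, 0 ≤ φ x) →
    ∫ x in D, inner ℝ (flux h (G x)) (gradient φ x) ≤ 0

/-- `D` has `C¹` boundary: near each boundary point, and for a suitable unit vector `e` taken as
the direction of the last coordinate axis, `D` is the part above the graph of a `C¹` function `γ`
of the remaining coordinates `y' = y - ⟨e, y⟩ e`. -/
def HasC1Boundary (D : Set (EuclideanSpace ℝ (Fin n))) : Prop :=
  ∀ x ∈ frontier D, ∃ r > 0, ∃ e : EuclideanSpace ℝ (Fin n), ‖e‖ = 1 ∧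
    ∃ γ : EuclideanSpace ℝ (Fin n) → ℝ, ContDiff ℝ 1 γ ∧
      ∀ y ∈ Metric.ball x r, y ∈ D ↔ γ (y - inner ℝ e y • e) < inner ℝ e y

/-- `(n-1)`-dimensional surface (Hausdorff) measure on `∂D`. -/
def surfaceMeasure (D : Set (EuclideanSpace ℝ (Fin n))) : Measure (EuclideanSpace ℝ (Fin n)) :=
  (Measure.hausdorffMeasure ((n : ℝ) - 1)).restrict (frontier D)

/-- `T` is the trace on `∂D` of the function `u` with weak gradient `G`: the trace operator is the
continuous extension of the restriction map `w ↦ w|_∂D` from functions that are `C¹` up to the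
boundary, with respect to the (local) `W^{1,1}(D)` and `L¹(∂D)` norms. -/
def HasTrace (D : Set (EuclideanSpace ℝ (Fin n))) (u : EuclideanSpace ℝ (Fin n) → ℝ)
    (G : EuclideanSpace ℝ (Fin n) → EuclideanSpace ℝ (Fin n))
    (T : EuclideanSpace ℝ (Fin n) → ℝ) : Prop :=
  AEStronglyMeasurable T (surfaceMeasure D) ∧
  ∃ w : ℕ → EuclideanSpace ℝ (Fin n) → ℝ, (∀ k, ContDiff ℝ 1 (w k)) ∧ ∀ R > 0,
    Tendsto (fun k => ∫⁻ x in D ∩ Metric.ball 0 R, ‖w k x - u x‖ₑ) atTop (𝓝 0) ∧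
    Tendsto (fun k => ∫⁻ x in D ∩ Metric.ball 0 R, ‖gradient (w k) x - G x‖ₑ) atTop (𝓝 0) ∧
    Tendsto (fun k => ∫⁻ x in Metric.ball 0 R, ‖w k x - T x‖ₑ ∂(surfaceMeasure D))
      atTop (𝓝 0)

/-- `v ≤ u` on `∂D` in the sense of the trace operator. -/
def TraceLE (D : Set (EuclideanSpace ℝ (Fin n)))
    (v : EuclideanSpace ℝ (Fin n) → ℝ)
    (Gv : EuclideanSpace ℝ (Fin n) → EuclideanSpace ℝ (Fin n))
    (u : EuclideanSpace ℝ (Fin n) → ℝ)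
    (Gu : EuclideanSpace ℝ (Fin n) → EuclideanSpace ℝ (Fin n)) : Prop :=
  ∃ Tv Tu : EuclideanSpace ℝ (Fin n) → ℝ, HasTrace D v Gv Tv ∧ HasTrace D u Gu Tu ∧
    ∀ᵐ x ∂(surfaceMeasure D), Tv x ≤ Tu x

end HComparison

end

noncomputable section

namespace HComparison

variable {n : ℕ}

/-! ### The profile `h` and strict monotonicity of the flux. -/

section Profile

variable {h : ℝ → ℝ}

/-! The difference of the two weak relations is tested with `η · β(v - u)`, where `β` is a smooth
truncation vanishing on `(-∞, ε]` and `η` is a cut-off at scale `R`. Since `ξ ↦ H(|ξ|)ξ` is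
monotone, this bounds the nonnegative quantity `∫ η β'(v - u) ⟨flux ∇v - flux ∇u, ∇v - ∇u⟩` by `C/R`
times the integral of `h(|∇v|) + h(|∇u|)` over `{v - u ≥ ε}`. That set has finite measure because
`u` and `v` lie in `L^p` or `L^F`, so the last integral is finite and the bound disappears as `R →
∞`, even in an unbounded domain. Strict monotonicity then gives `β'(v - u)(∇v - ∇u) = 0`
(`ae_deriv_smul_sub_eq_zero`). So `β(v - u)`, extended by zero, is integrable on the whole space
with zero gradient; it is constant, hence zero because the space has infinite volume
(`HasZeroExtension.ae_eq_zero`). Letting `ε → 0` gives `v ≤ u`.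

The boundary enters twice, each time through the cone of directions that lead into a `C¹` domain
(`HasC1Boundary.exists_cone`). Firstly, `β(v - u)` must extend by zero without a jump
(`HasNonposTrace.hasZeroExtension`). Integration along lines in a cone direction bounds `∫_D ∂_ξ g`
by the surface integral of `|g|`. This is applied to `g = β(z_k) ψ` with smooth `z_k → v - u`, where
the surface integral tends to `0` because the trace is nonpositive and `β` vanishes on negative
values.

Secondly, `η · β(v - u)` is not smooth and reaches the boundary. Locally it is convolved with a
kernel supported in the cone, which pushes its support into `D`
(`setIntegral_inner_nonpos_of_cone`). The passage to the limit rests on continuity of translations,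
weighted by `h(|∇u|)` or `h(|∇v|)`. It uses only `h(s)t ≤ s h(s) + t h(t)` and truncation at a high
level, so the power and Orlicz cases are treated together. -/

lemma IsProfile.nonneg (hh : IsProfile h) {t : ℝ} (ht : 0 ≤ t) : 0 ≤ h t := by
  rw [← hh.map_zero]
  exact hh.strictMonoOn.monotoneOn self_mem_Ici ht ht

lemma IsProfile.pos (hh : IsProfile h) {t : ℝ} (ht : 0 < t) : 0 < h t := by
  rw [← hh.map_zero]
  exact hh.strictMonoOn self_mem_Ici ht.le ht

lemma IsProfile.mono (hh : IsProfile h) {s t : ℝ} (hs : 0 ≤ s) (hst : s ≤ t) : h s ≤ h t :=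
  hh.strictMonoOn.monotoneOn hs (hs.trans hst : (0 : ℝ) ≤ t) hst

lemma IsProfile.mul_mono (hh : IsProfile h) {s t : ℝ} (hs : 0 ≤ s) (hst : s ≤ t) :
    s * h s ≤ t * h t :=
  mul_le_mul hst (hh.mono hs hst) (hh.nonneg hs) (hs.trans hst)

lemma IsProfile.mul_nonneg (hh : IsProfile h) {t : ℝ} (ht : 0 ≤ t) : 0 ≤ t * h t :=
  _root_.mul_nonneg ht (hh.nonneg ht)

/-- Young-type inequality: a mixed product is dominated by the sum of the diagonal ones. -/
lemma IsProfile.mul_le_add (hh : IsProfile h) {s t : ℝ} (hs : 0 ≤ s) (ht : 0 ≤ t) :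
    h s * t ≤ s * h s + t * h t := by
  rcases le_total s t with hst | hst
  · nlinarith [hh.mono hs hst, hh.mul_nonneg hs]
  · nlinarith [hh.nonneg hs, hh.mul_nonneg ht]

lemma IsProfile.continuous_norm (hh : IsProfile h) {V : Type*} [NormedAddCommGroup V] :
    Continuous fun ξ : V => h ‖ξ‖ :=
  hh.continuousOn.comp_continuous _root_.continuous_norm fun ξ => norm_nonneg ξ

lemma measurable_flux (hh : IsProfile h) :
    Measurable (flux h : EuclideanSpace ℝ (Fin n) → EuclideanSpace ℝ (Fin n)) := by
  unfold flux
  exact ((hh.continuous_norm.measurable).div measurable_norm).smul measurable_id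

lemma norm_flux (hh : IsProfile h) (ξ : EuclideanSpace ℝ (Fin n)) : ‖flux h ξ‖ = h ‖ξ‖ := by
  unfold flux
  rcases eq_or_ne ξ 0 with rfl | hξ
  · simp [hh.map_zero]
  · have : 0 < ‖ξ‖ := norm_pos_iff.mpr hξ
    rw [norm_smul, Real.norm_of_nonneg (div_nonneg (hh.nonneg this.le) this.le)]
    field_simp

lemma inner_flux_self (ξ : EuclideanSpace ℝ (Fin n)) :
    inner ℝ (flux h ξ) ξ = h ‖ξ‖ * ‖ξ‖ := by
  unfold flux
  rcases eq_or_ne ξ 0 with rfl | hξ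
  · simp
  · have : 0 < ‖ξ‖ := norm_pos_iff.mpr hξ
    rw [real_inner_smul_left, real_inner_self_eq_norm_sq]
    field_simp

lemma inner_flux_le (hh : IsProfile h) (a b : EuclideanSpace ℝ (Fin n)) :
    inner ℝ (flux h a) b ≤ h ‖a‖ * ‖b‖ := by
  rw [← norm_flux hh]
  exact real_inner_le_norm _ _

/-- Cauchy–Schwarz on the two mixed terms reduces vector monotonicity to scalar monotonicity of `h`.
-/
lemma norm_sub_mul_le_inner_flux_sub (hh : IsProfile h) (a b : EuclideanSpace ℝ (Fin n)) :
    (h ‖a‖ - h ‖b‖) * (‖a‖ - ‖b‖) ≤ inner ℝ (flux h a - flux h b) (a - b) := by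
  have h1 := inner_flux_le hh a b
  have h2 := inner_flux_le hh b a
  rw [inner_sub_left, inner_sub_right, inner_sub_right, inner_flux_self, inner_flux_self]
  linarith

lemma inner_flux_sub_nonneg (hh : IsProfile h) (a b : EuclideanSpace ℝ (Fin n)) :
    0 ≤ inner ℝ (flux h a - flux h b) (a - b) := by
  refine le_trans ?_ (norm_sub_mul_le_inner_flux_sub hh a b)
  rcases le_total ‖a‖ ‖b‖ with hab | hab
  · nlinarith [hh.mono (norm_nonneg a) hab]
  · nlinarith [hh.mono (norm_nonneg b) hab]

/-- Strict monotonicity of `h` forces equal norms. The two fluxes then have the same factor, so the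
inner product is a positive multiple of `‖a - b‖ ^ 2`. -/
lemma eq_of_inner_flux_sub_eq_zero (hh : IsProfile h) {a b : EuclideanSpace ℝ (Fin n)}
    (hab : inner ℝ (flux h a - flux h b) (a - b) = 0) : a = b := by
  have h0 := norm_sub_mul_le_inner_flux_sub hh a b
  rw [hab] at h0
  have hn : ‖a‖ = ‖b‖ := by
    rcases lt_trichotomy ‖a‖ ‖b‖ with hlt | heq | hlt
    · nlinarith [hh.strictMonoOn (norm_nonneg a) (norm_nonneg b) hlt]
    · exact heq
    · nlinarith [hh.strictMonoOn (norm_nonneg b) (norm_nonneg a) hlt]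
  rcases eq_or_ne a 0 with rfl | ha
  · exact (norm_eq_zero.mp (by rw [← hn, norm_zero])).symm
  · have hpos : 0 < ‖a‖ := norm_pos_iff.mpr ha
    unfold flux at hab
    rw [← hn, ← smul_sub, real_inner_smul_left, real_inner_self_eq_norm_sq] at hab
    have hq : h ‖a‖ / ‖a‖ ≠ 0 := (div_pos (hh.pos hpos) hpos).ne'
    have : ‖a - b‖ ^ 2 = 0 := (mul_eq_zero.mp hab).resolve_left hq
    exact sub_eq_zero.mp (norm_eq_zero.mp (pow_eq_zero_iff two_ne_zero |>.mp this))

end Profile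

/-! ### The energy density, local finiteness of energy, and superlevel sets. -/

section Energy

variable {h : ℝ → ℝ}

lemma IsProfile.intervalIntegrable (hh : IsProfile h) {a b : ℝ} (ha : 0 ≤ a) (hb : 0 ≤ b) :
    IntervalIntegrable h volume a b := by
  refine ContinuousOn.intervalIntegrable (hh.continuousOn.mono fun x hx => ?_)
  exact (le_min ha hb).trans hx.1

lemma energy_mono (hh : IsProfile h) {s t : ℝ} (hs : 0 ≤ s) (hst : s ≤ t) :
    energy h s ≤ energy h t := by
  unfold energy
  rw [← intervalIntegral.integral_add_adjacent_intervals
    (hh.intervalIntegrable le_rfl hs) (hh.intervalIntegrable hs (hs.trans hst))]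
  have : 0 ≤ ∫ τ in s..t, h τ :=
    intervalIntegral.integral_nonneg hst fun u hu => hh.nonneg (hs.trans hu.1)
  linarith

lemma energy_nonneg (hh : IsProfile h) {t : ℝ} (ht : 0 ≤ t) : 0 ≤ energy h t :=
  intervalIntegral.integral_nonneg ht fun _ hu => hh.nonneg hu.1

/-- On `[t, 2t]` the integrand of `energy h` is at least `h t`. -/
lemma mul_le_energy_two_mul (hh : IsProfile h) {t : ℝ} (ht : 0 ≤ t) :
    t * h t ≤ energy h (2 * t) := by
  have ht2 : t ≤ 2 * t := by linarith
  unfold energy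
  rw [← intervalIntegral.integral_add_adjacent_intervals
    (hh.intervalIntegrable le_rfl ht) (hh.intervalIntegrable ht (ht.trans ht2))]
  have h1 : 0 ≤ ∫ τ in (0 : ℝ)..t, h τ := energy_nonneg hh ht
  have h2 : ∫ τ in t..2 * t, h t ≤ ∫ τ in t..2 * t, h τ :=
    intervalIntegral.integral_mono_on ht2 (by simp)
      (hh.intervalIntegrable ht (ht.trans ht2)) fun x hx => hh.mono ht hx.1
  rw [intervalIntegral.integral_const, smul_eq_mul] at h2
  linarith

lemma energy_pos (hh : IsProfile h) {t : ℝ} (ht : 0 < t) : 0 < energy h t := by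
  have h1 := mul_le_energy_two_mul hh (t := t / 2) (by positivity)
  rw [mul_div_cancel₀ t two_ne_zero] at h1
  have : 0 < t / 2 * h (t / 2) := mul_pos (by positivity) (hh.pos (by positivity))
  linarith

/-- `Δ₂` at infinity controls every dilation of the energy, up to an additive constant. -/
lemma Delta2.energy_dilation_le (hh : IsProfile h) (hF : Delta2 (energy h)) {c : ℝ} (hc : 0 ≤ c) :
    ∃ A ≥ 0, ∃ B ≥ 0, ∀ t ≥ 0, energy h (c * t) ≤ A * energy h t + B := by
  obtain ⟨t₀, ht₀, C₀, hC₀, hD⟩ := hF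
  have key : ∀ j : ℕ, ∀ t > t₀, energy h (2 ^ j * t) ≤ C₀ ^ j * energy h t := by
    intro j
    induction j with
    | zero => intro t _; simp
    | succ j ih =>
      intro t ht
      have ht' : t₀ < 2 ^ j * t := by
        have : (1 : ℝ) ≤ 2 ^ j := one_le_pow₀ (by norm_num)
        nlinarith
      calc energy h (2 ^ (j + 1) * t) = energy h (2 * (2 ^ j * t)) := by ring_nf
        _ ≤ C₀ * energy h (2 ^ j * t) := hD _ ht'
        _ ≤ C₀ * (C₀ ^ j * energy h t) := by gcongr; exact ih t ht
        _ = C₀ ^ (j + 1) * energy h t := by ring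
  obtain ⟨j, hj⟩ := pow_unbounded_of_one_lt c (one_lt_two : (1 : ℝ) < 2)
  -- Below `t₀`, where `Δ₂` says nothing, monotonicity bounds the dilated energy by its value at `2
  -- ^ j * t₀`; this is the additive constant.
  refine ⟨C₀ ^ j, by positivity, energy h (2 ^ j * t₀), energy_nonneg hh (by positivity), ?_⟩
  intro t ht
  have hneg : energy h (c * t) ≤ energy h (2 ^ j * t) := by
    exact energy_mono hh (by positivity) (mul_le_mul_of_nonneg_right hj.le ht)
  refine hneg.trans ?_
  rcases le_or_gt t t₀ with h1 | h1
  · have := energy_mono hh (s := 2 ^ j * t) (t := 2 ^ j * t₀) (by positivity) (by gcongr)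
    have := mul_nonneg (pow_nonneg hC₀.le j) (energy_nonneg hh ht)
    linarith
  · have := key j t h1
    have := energy_nonneg hh (t := 2 ^ j * t₀) (by positivity)
    linarith

end Energy

/-- Local finiteness of the energy of `G`: on subsets of `D` of finite measure, every dilation of
`|G| h(|G|)` is integrable. -/
def HasFiniteEnergy (h : ℝ → ℝ) (D : Set (EuclideanSpace ℝ (Fin n)))
    (G : EuclideanSpace ℝ (Fin n) → EuclideanSpace ℝ (Fin n)) : Prop :=
  ∀ c ≥ 0, ∀ S ⊆ D, volume S < ⊤ →
    ∫⁻ x in S, ENNReal.ofReal (c * ‖G x‖ * h (c * ‖G x‖)) < ⊤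

lemma setLIntegral_lt_top_of_le_add {α : Type*} [MeasurableSpace α] {μ : Measure α}
    {S D : Set α} (hSD : S ⊆ D) (hS : μ S < ⊤) {f g : α → ENNReal} {a b : ENNReal}
    (ha : a ≠ ⊤) (hb : b ≠ ⊤) (hfg : ∀ x, f x ≤ a * g x + b) (hg : ∫⁻ x in D, g x ∂μ < ⊤) :
    ∫⁻ x in S, f x ∂μ < ⊤ := by
  calc ∫⁻ x in S, f x ∂μ ≤ ∫⁻ x in S, (a * g x + b) ∂μ := lintegral_mono hfg
    _ = a * ∫⁻ x in S, g x ∂μ + b * μ S := by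
        rw [lintegral_add_right _ measurable_const, lintegral_const_mul' _ _ ha, setLIntegral_const]
    _ < ⊤ := by
        refine ENNReal.add_lt_top.mpr ⟨ENNReal.mul_lt_top ha.lt_top ?_, ENNReal.mul_lt_top hb.lt_top hS⟩
        exact (lintegral_mono_set hSD).trans_lt hg

lemma MemSobolev.hasFiniteEnergy {h : ℝ → ℝ} {p : ℝ} (hp : 1 < p) (hg : HasPowerGrowth h p)
    {D : Set (EuclideanSpace ℝ (Fin n))} {u : EuclideanSpace ℝ (Fin n) → ℝ}
    {G : EuclideanSpace ℝ (Fin n) → EuclideanSpace ℝ (Fin n)} (hu : MemSobolev p D u G) :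
    HasFiniteEnergy h D G := by
  obtain ⟨_, _, C, hC, hb⟩ := hg
  intro c hc S hSD hS
  have hp0 : 0 < p := by linarith
  have hG := lintegral_rpow_enorm_lt_top_of_eLpNorm_lt_top (by simpa using hp0) (by simp)
    hu.memLp_grad.2
  rw [ENNReal.toReal_ofReal hp0.le] at hG
  refine setLIntegral_lt_top_of_le_add hSD hS (a := ENNReal.ofReal (C * c ^ p)) (b := 0)
    ENNReal.ofReal_ne_top (by simp) (fun x => ?_) hG
  rw [add_zero, ← ofReal_norm, ENNReal.ofReal_rpow_of_nonneg (norm_nonneg _) hp0.le,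
    ← ENNReal.ofReal_mul (by positivity)]
  refine ENNReal.ofReal_le_ofReal ?_
  rw [mul_assoc C, ← Real.mul_rpow hc (norm_nonneg _)]
  rcases (mul_nonneg hc (norm_nonneg (G x))).eq_or_lt with h0 | h0
  · rw [← h0]
    simp [Real.zero_rpow hp0.ne']
  · calc c * ‖G x‖ * h (c * ‖G x‖) ≤ c * ‖G x‖ * (C * (c * ‖G x‖) ^ (p - 1)) :=
          mul_le_mul_of_nonneg_left (hb _ h0).2.le h0.le
      _ = C * ((c * ‖G x‖) ^ (p - 1) * (c * ‖G x‖) ^ (1 : ℝ)) := by rw [Real.rpow_one]; ring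
      _ = C * (c * ‖G x‖) ^ p := by rw [← Real.rpow_add h0]; ring_nf

/-- The chain is `s h(s) ≤ F(2s)` with `s = c|G|`, then `Δ₂` applied to `2c|G| = (2cM)(|G|/M)`. The
additive constant left by `Δ₂` is integrable because the set has finite measure. -/
lemma MemSobolevOrlicz.hasFiniteEnergy {h : ℝ → ℝ} (hh : IsProfile h)
    (hF : Delta2 (energy h))
    {D : Set (EuclideanSpace ℝ (Fin n))} {u : EuclideanSpace ℝ (Fin n) → ℝ}
    {G : EuclideanSpace ℝ (Fin n) → EuclideanSpace ℝ (Fin n)}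
    (hu : MemSobolevOrlicz (energy h) D u G) :
    HasFiniteEnergy h D G := by
  obtain ⟨-, M, hM, hG⟩ := hu.memOrlicz_grad
  intro c hc S hSD hS
  obtain ⟨A, hA, B, hB, hAB⟩ := Delta2.energy_dilation_le hh hF (c := 2 * c * M) (by positivity)
  refine setLIntegral_lt_top_of_le_add hSD hS (a := ENNReal.ofReal A) (b := ENNReal.ofReal B)
    ENNReal.ofReal_ne_top ENNReal.ofReal_ne_top (fun x => ?_) (hG.trans_lt ENNReal.ofReal_lt_top)
  rw [← ENNReal.ofReal_mul hA,
    ← ENNReal.ofReal_add (mul_nonneg hA (energy_nonneg hh (by positivity))) hB]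
  refine ENNReal.ofReal_le_ofReal ?_
  refine (mul_le_energy_two_mul hh (by positivity)).trans ?_
  refine le_trans (le_of_eq ?_) (hAB (‖G x‖ / M) (by positivity))
  congr 1
  field_simp

/-- Chebyshev's inequality without measurability of the integrand. -/
lemma measure_lt_top_of_le_lintegral {α : Type*} [MeasurableSpace α] {μ : Measure α}
    {S : Set α} (hS : NullMeasurableSet S μ) {f : α → ENNReal} {a : ENNReal} (ha : a ≠ 0)
    (hfS : ∀ x ∈ S, a ≤ f x) (hf : ∫⁻ x, f x ∂μ < ⊤) : μ S < ⊤ := by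
  have h1 : a * μ S ≤ ∫⁻ x, f x ∂μ := by
    rw [← lintegral_indicator_const₀ hS]
    refine lintegral_mono fun x => ?_
    by_cases hx : x ∈ S
    · simpa [hx] using hfS x hx
    · simp [hx]
  by_contra hcon
  rw [not_lt, top_le_iff] at hcon
  rw [hcon, ENNReal.mul_top ha] at h1
  exact absurd (h1.trans_lt hf) (by simp)

lemma MemSobolev.measure_le_norm_lt_top {p : ℝ} (hp : 1 < p)
    {D : Set (EuclideanSpace ℝ (Fin n))} {u : EuclideanSpace ℝ (Fin n) → ℝ}
    {G : EuclideanSpace ℝ (Fin n) → EuclideanSpace ℝ (Fin n)} (hu : MemSobolev p D u G)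
    {ε : ℝ} (hε : 0 < ε) : volume.restrict D {x | ε ≤ ‖u x‖} < ⊤ := by
  have hp0 : 0 < p := by linarith
  have hG := lintegral_rpow_enorm_lt_top_of_eLpNorm_lt_top (by simpa using hp0) (by simp)
    hu.memLp.2
  rw [ENNReal.toReal_ofReal hp0.le] at hG
  refine measure_lt_top_of_le_lintegral
    (nullMeasurableSet_le aemeasurable_const hu.memLp.1.norm.aemeasurable)
    (a := ENNReal.ofReal (ε ^ p)) (by simpa using Real.rpow_pos_of_pos hε p) (fun x hx => ?_) hG
  rw [← ofReal_norm, ENNReal.ofReal_rpow_of_nonneg (norm_nonneg _) hp0.le]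
  exact ENNReal.ofReal_le_ofReal (Real.rpow_le_rpow hε.le hx hp0.le)

lemma MemSobolevOrlicz.measure_le_norm_lt_top {h : ℝ → ℝ} (hh : IsProfile h)
    {D : Set (EuclideanSpace ℝ (Fin n))} {u : EuclideanSpace ℝ (Fin n) → ℝ}
    {G : EuclideanSpace ℝ (Fin n) → EuclideanSpace ℝ (Fin n)}
    (hu : MemSobolevOrlicz (energy h) D u G)
    {ε : ℝ} (hε : 0 < ε) : volume.restrict D {x | ε ≤ ‖u x‖} < ⊤ := by
  obtain ⟨hum, M, hM, hG⟩ := hu.memOrlicz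
  refine measure_lt_top_of_le_lintegral
    (nullMeasurableSet_le aemeasurable_const hum.norm.aemeasurable)
    (a := ENNReal.ofReal (energy h (ε / M))) (by simpa using energy_pos hh (by positivity))
    (fun x hx => ?_) (hG.trans_lt ENNReal.ofReal_lt_top)
  exact ENNReal.ofReal_le_ofReal
    (energy_mono hh (by positivity) (div_le_div_of_nonneg_right hx hM.le))

/-- If `v - u ≥ ε` then `|u|` or `|v|` is at least `ε / 2`. This finiteness makes the cut-off error
harmless in unbounded domains. -/
lemma measure_lt_sub_lt_top {μ : Measure (EuclideanSpace ℝ (Fin n))}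
    {u v : EuclideanSpace ℝ (Fin n) → ℝ}
    (hu : ∀ ε > 0, μ {x | ε ≤ ‖u x‖} < ⊤) (hv : ∀ ε > 0, μ {x | ε ≤ ‖v x‖} < ⊤)
    {ε : ℝ} (hε : 0 < ε) : μ {x | ε ≤ v x - u x} < ⊤ := by
  refine (measure_mono (fun x (hx : ε ≤ v x - u x) => ?_)).trans_lt
    (measure_union_lt_top (hu (ε / 2) (half_pos hε)) (hv (ε / 2) (half_pos hε)))
  by_contra hcon
  simp only [mem_union, mem_ofPred_eq, not_or, not_le, Real.norm_eq_abs] at hcon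
  linarith [neg_abs_le (u x), le_abs_self (v x), hcon.1, hcon.2]

/-! ### One-dimensional integration up to an entry point. -/

section LineIntegral

/-- Integration of a derivative over a set that is upward closed within the support. -/
lemma setIntegral_deriv_of_upward {f : ℝ → ℝ} (hf : ContDiff ℝ 1 f) (hc : HasCompactSupport f)
    {S V : Set ℝ} (hS : IsOpen S) (hV : IsOpen V) (hb : BddBelow V) (hfV : tsupport f ⊆ V)
    (hup : ∀ s ∈ S, s ∈ V → ∀ t > s, t ∈ V → t ∈ S) :
    ∫ s in S, deriv f s = 0 ∨ ∃ s₀ ∈ frontier S, ∫ s in S, deriv f s = -f s₀ := by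
  have hzero : ∀ s, s ∉ V → deriv f s = 0 := fun s hs => by
    by_contra hcon
    exact hs (hfV (support_deriv_subset hcon))
  have hzero' : ∀ s, s ∉ V → f s = 0 := fun s hs => by
    by_contra hcon
    exact hs (hfV (subset_tsupport f hcon))
  rcases (S ∩ V).eq_empty_or_nonempty with hT | hT
  · left
    refine setIntegral_eq_zero_of_forall_eq_zero fun s hs => hzero s fun hsV => ?_
    exact (hT ▸ (⟨hs, hsV⟩ : s ∈ S ∩ V) : s ∈ (∅ : Set ℝ))
  · have hbT : BddBelow (S ∩ V) := hb.mono inter_subset_right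
    -- The entry point: inside `V`, upward closedness makes `S` coincide with `Ioi s₀`.
    set s₀ := sInf (S ∩ V) with hs₀
    have hcl : s₀ ∈ closure (S ∩ V) := csInf_mem_closure hT hbT
    have hnot : s₀ ∉ S ∩ V := by
      intro hmem
      obtain ⟨δ, hδ, hball⟩ := Metric.isOpen_iff.mp (hS.inter hV) s₀ hmem
      have h1 : s₀ - δ / 2 ∈ S ∩ V := hball (by
        rw [Metric.mem_ball, Real.dist_eq]
        rw [show s₀ - δ / 2 - s₀ = -(δ / 2) by ring, abs_neg, abs_of_pos (half_pos hδ)]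
        linarith)
      linarith [csInf_le hbT h1]
    have hint : ∫ s in S, deriv f s = ∫ s in Ioi s₀, deriv f s := by
      rw [← integral_indicator hS.measurableSet, ← integral_indicator measurableSet_Ioi]
      congr 1
      funext s
      by_cases hsV : s ∈ V
      · have : s ∈ S ↔ s ∈ Ioi s₀ := by
          constructor
          · intro hs
            refine lt_of_le_of_ne (csInf_le hbT ⟨hs, hsV⟩) fun heq => hnot ?_
            rw [hs₀, heq]
            exact ⟨hs, hsV⟩
          · intro hs
            obtain ⟨t, ht, hts⟩ := exists_lt_of_csInf_lt hT hs
            exact hup t ht.1 ht.2 s hts hsV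
        by_cases hs : s ∈ S
        · rw [indicator_of_mem hs, indicator_of_mem (this.mp hs)]
        · rw [indicator_of_notMem hs, indicator_of_notMem (fun h => hs (this.mpr h))]
      · simp [indicator, hzero s hsV]
    rw [hint, HasCompactSupport.integral_Ioi_deriv_eq hf hc]
    -- If the entry point lies in `V` it is a genuine boundary point of `S`; otherwise `f` vanishes
    -- there.
    by_cases hsV : s₀ ∈ V
    · right
      refine ⟨s₀, ?_, rfl⟩
      rw [hS.frontier_eq]
      exact ⟨closure_mono inter_subset_left hcl, fun h => hnot ⟨h, hsV⟩⟩
    · left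
      simp [hzero' s₀ hsV]

end LineIntegral

/-! ### Trace inequality by slicing along a direction. -/

section TraceInequality

variable {m : ℕ}

/-- Euclidean coordinates adapted to a unit vector `θ`: lines parallel to `θ`, and the orthogonal
projection along `θ`. -/
lemma exists_line_coordinates (θ : EuclideanSpace ℝ (Fin (m + 1))) (hθ : ‖θ‖ = 1) :
    ∃ (Ψ : ℝ × (Fin m → ℝ) ≃ᵐ EuclideanSpace ℝ (Fin (m + 1)))
      (P : EuclideanSpace ℝ (Fin (m + 1)) → (Fin m → ℝ)),
      MeasurePreserving Ψ volume volume ∧ LipschitzWith 1 P ∧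
      (∀ s y, P (Ψ (s, y)) = y) ∧ ∀ s y, Ψ (s, y) = Ψ (0, y) + s • θ := by
  let e₀ : EuclideanSpace ℝ (Fin (m + 1)) := EuclideanSpace.single 0 1
  -- The reflection exchanging the first basis vector with `θ`; the coordinates are the standard
  -- ones rotated by `L`.
  let L := (Submodule.span ℝ {e₀ - θ})ᗮ.reflection
  have hL : L e₀ = θ := Submodule.reflection_sub (by simp [e₀, hθ])
  let A := (MeasurableEquiv.piFinSuccAbove (fun _ : Fin (m + 1) => ℝ) 0).symm
  have hA : MeasurePreserving A volume volume :=
    (volume_preserving_piFinSuccAbove (fun _ : Fin (m + 1) => ℝ) 0).symm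
  let B := MeasurableEquiv.toLp 2 (Fin (m + 1) → ℝ)
  have hB : MeasurePreserving B volume volume :=
    (EuclideanSpace.volume_preserving_symm_measurableEquiv_toLp (Fin (m + 1))).symm
  have hAB : ∀ s y, B (A (s, y)) = WithLp.toLp 2 (Fin.cons s y : Fin (m + 1) → ℝ) := by
    intro s y
    simp only [A, B, MeasurableEquiv.piFinSuccAbove, MeasurableEquiv.symm]
    ext j
    refine Fin.cases ?_ (fun i => ?_) j <;> simp
  refine ⟨(A.trans B).trans L.toMeasurableEquiv, fun x i => (L.symm x) i.succ, ?_, ?_, ?_, ?_⟩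
  · exact L.measurePreserving.comp (hB.comp hA)
  · refine LipschitzWith.of_dist_le_mul fun x y => ?_
    rw [NNReal.coe_one, one_mul, dist_pi_le_iff dist_nonneg]
    intro i
    rw [← L.symm.dist_map x y, dist_eq_norm, dist_eq_norm]
    exact PiLp.norm_apply_le (L.symm x - L.symm y) i.succ
  · intro s y
    funext i
    change L.symm (L (B (A (s, y)))) i.succ = y i
    rw [L.symm_apply_apply, hAB]
    simp
  · intro s y
    change L (B (A (s, y))) = L (B (A (0, y))) + s • θ
    rw [hAB, hAB, ← hL, ← map_smul, ← map_add]
    congr 1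
    ext j
    refine Fin.cases ?_ (fun i => ?_) j <;> simp [e₀]

/-- Trace inequality: if `D` is upward closed in direction `θ` within a ball, then the integral
over `D` of an `θ`-derivative is controlled by the boundary integral of the function. -/
lemma enorm_setIntegral_fderiv_le_of_upward {D : Set (EuclideanSpace ℝ (Fin (m + 1)))}
    (hD : IsOpen D) {θ : EuclideanSpace ℝ (Fin (m + 1))} (hθ : ‖θ‖ = 1)
    {x : EuclideanSpace ℝ (Fin (m + 1))} {r : ℝ}
    (hup : ∀ y ∈ D, y ∈ Metric.ball x r → ∀ t > (0 : ℝ), y + t • θ ∈ Metric.ball x r → y + t • θ ∈ D)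
    {g : EuclideanSpace ℝ (Fin (m + 1)) → ℝ} (hg : ContDiff ℝ 1 g)
    (hgs : tsupport g ⊆ Metric.ball x r) :
    ‖∫ y in D, fderiv ℝ g y θ‖ₑ ≤ ∫⁻ y in frontier D, ‖g y‖ₑ ∂(Measure.hausdorffMeasure (m : ℝ)) := by
  obtain ⟨Ψ, P, hΨ, hP, hPΨ, hline⟩ := exists_line_coordinates θ hθ
  have hgc : HasCompactSupport g :=
    HasCompactSupport.of_support_subset_isCompact (isCompact_closedBall x r)
      ((subset_tsupport g).trans (hgs.trans Metric.ball_subset_closedBall))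
  have hF : Continuous fun y => fderiv ℝ g y θ :=
    (hg.continuous_fderiv one_ne_zero).clm_apply continuous_const
  have hFc : HasCompactSupport fun y => fderiv ℝ g y θ := hgc.fderiv_apply ℝ θ
  let F : EuclideanSpace ℝ (Fin (m + 1)) → ℝ := D.indicator fun y => fderiv ℝ g y θ
  have hFi : Integrable F := (hF.integrable_of_hasCompactSupport hFc).indicator hD.measurableSet
  have hFm : StronglyMeasurable F := hF.stronglyMeasurable.indicator hD.measurableSet
  -- The contribution of each line parallel to `θ`. By the one-dimensional lemma it is `0` or minus
  -- the value of `g` at some boundary point on that line.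
  let M : (Fin m → ℝ) → ℝ := fun y => ∫ s, F (Ψ (s, y))
  have hM : StronglyMeasurable M := by
    refine StronglyMeasurable.integral_prod_right (f := fun y s => F (Ψ (s, y))) ?_
    exact hFm.comp_measurable (Ψ.measurable.comp measurable_swap)
  have hint : ∫ y in D, fderiv ℝ g y θ = ∫ y, M y := by
    rw [← integral_indicator hD.measurableSet]
    change ∫ y, F y = _
    rw [← hΨ.integral_comp']
    have : Integrable (fun z => F (Ψ z)) (volume : Measure (ℝ × (Fin m → ℝ))) :=
      hΨ.integrable_comp_of_integrable hFi
    rw [Measure.volume_eq_prod] at this ⊢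
    rw [integral_prod_symm _ this]
  have hptw : ∀ y, M y = 0 ∨ ∃ z ∈ frontier D, P z = y ∧ M y = -g z := by
    intro y
    have hfun : (fun s => Ψ (s, y)) = fun s => Ψ (0, y) + s • θ := funext fun s => hline s y
    have hlc : ∀ s, HasDerivAt (fun s => Ψ (s, y)) θ s := by
      intro s
      rw [hfun]
      simpa using ((hasDerivAt_id s).smul_const θ).const_add (Ψ (0, y))
    have hcont : Continuous fun s => Ψ (s, y) := by
      rw [hfun]
      fun_prop
    have hemb : IsClosedEmbedding fun s => Ψ (s, y) := by
      refine Isometry.isClosedEmbedding (Isometry.of_dist_eq fun s t => ?_)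
      rw [hline s y, hline t y, dist_add_left, dist_eq_norm, ← sub_smul, norm_smul, hθ, mul_one,
        Real.dist_eq, Real.norm_eq_abs]
    have hsm : ContDiff ℝ 1 fun s => g (Ψ (s, y)) := by
      have : ContDiff ℝ 1 fun s => Ψ (s, y) := by
        rw [hfun]
        fun_prop
      exact hg.comp this
    have hder : ∀ s, deriv (fun s => g (Ψ (s, y))) s = fderiv ℝ g (Ψ (s, y)) θ := fun s =>
      (((hg.differentiable one_ne_zero) _).hasFDerivAt.comp_hasDerivAt s (hlc s)).deriv
    have hMy : M y = ∫ s in (fun s => Ψ (s, y)) ⁻¹' D, deriv (fun s => g (Ψ (s, y))) s := by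
      rw [← integral_indicator (hcont.measurable hD.measurableSet)]
      refine integral_congr_ae (ae_of_all _ fun s => ?_)
      rw [show (deriv fun s => g (Ψ (s, y))) = fun s => fderiv ℝ g (Ψ (s, y)) θ from funext hder]
      exact (indicator_comp_right (s := D) (fun s => Ψ (s, y))
        (g := fun z => fderiv ℝ g z θ)).symm
    have := setIntegral_deriv_of_upward (S := (fun s => Ψ (s, y)) ⁻¹' D)
      (V := (fun s => Ψ (s, y)) ⁻¹' Metric.ball x r) hsm (hgc.comp_isClosedEmbedding hemb)
      (hD.preimage hcont) (Metric.isOpen_ball.preimage hcont) ?_ ?_ ?_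
    · rcases this with h0 | ⟨s₀, hs₀, heq⟩
      · exact Or.inl (hMy.trans h0)
      · exact Or.inr ⟨Ψ (s₀, y), hcont.frontier_preimage_subset D hs₀, hPΨ _ _, hMy.trans heq⟩
    · refine ⟨-(r + dist (Ψ (0, y)) x), fun s hs => ?_⟩
      have h1 : dist (Ψ (s, y)) (Ψ (0, y)) = |s| := by
        rw [hline s y, dist_eq_norm, add_sub_cancel_left, norm_smul, hθ, mul_one, Real.norm_eq_abs]
      have h2 : dist (Ψ (s, y)) x < r := hs
      have h3 := dist_triangle_right (Ψ (s, y)) (Ψ (0, y)) x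
      linarith [neg_abs_le s]
    · exact (tsupport_comp_subset_preimage g hcont).trans (preimage_mono hgs)
    · intro s hs hsV t hst htV
      have h1 : Ψ (t, y) = Ψ (s, y) + (t - s) • θ := by
        rw [hline t y, hline s y, sub_smul]; abel
      have h2 := hup _ hs hsV (t - s) (sub_pos.mpr hst)
      rw [← h1] at h2
      exact h2 htV
  -- Keeping every boundary point that dominates the integral over its own line avoids a measurable
  -- selection of entry points; the projection of `A` still covers all lines with `M y ≠ 0`.
  let A : Set (EuclideanSpace ℝ (Fin (m + 1))) := {z | z ∈ frontier D ∧ ‖M (P z)‖ₑ ≤ ‖g z‖ₑ}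
  have hMm : Measurable fun y => ‖M y‖ₑ := hM.enorm
  have hA : MeasurableSet A :=
    isClosed_frontier.measurableSet.inter
      (measurableSet_le (hMm.comp hP.continuous.measurable) hg.continuous.enorm.measurable)
  -- A `1`-Lipschitz map does not increase Hausdorff measure, and on `Fin m → ℝ` with the sup metric
  -- `m`-dimensional Hausdorff measure is Lebesgue measure; hence the constant `1`.
  have hmeas : volume.restrict (P '' A) ≤ ((Measure.hausdorffMeasure (m : ℝ)).restrict A).map P := by
    refine Measure.le_iff.mpr fun B hB => ?_
    rw [Measure.restrict_apply hB, Measure.map_apply hP.continuous.measurable hB,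
      Measure.restrict_apply (hP.continuous.measurable hB)]
    have h1 : B ∩ P '' A = P '' (P ⁻¹' B ∩ A) := by
      rw [image_preimage_inter]
    rw [h1, ← hausdorffMeasure_pi_real, Fintype.card_fin]
    simpa using hP.hausdorffMeasure_image_le (d := m) (Nat.cast_nonneg m) (P ⁻¹' B ∩ A)
  rw [hint]
  calc ‖∫ y, M y‖ₑ ≤ ∫⁻ y, ‖M y‖ₑ := enorm_integral_le_lintegral_enorm _
    _ = ∫⁻ y in {y | ‖M y‖ₑ ≠ 0}, ‖M y‖ₑ := by
        refine (setLIntegral_eq_of_support_subset ?_).symm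
        exact fun y hy => hy
    _ ≤ ∫⁻ y in P '' A, ‖M y‖ₑ := by
        refine lintegral_mono_set fun y hy => ?_
        rcases hptw y with h0 | ⟨z, hz, hzy, hMz⟩
        · simp [h0] at hy
        · exact ⟨z, ⟨hz, by rw [hzy, hMz, enorm_neg]⟩, hzy⟩
    _ ≤ ∫⁻ y, ‖M y‖ₑ ∂(((Measure.hausdorffMeasure (m : ℝ)).restrict A).map P) :=
        lintegral_mono' hmeas le_rfl
    _ = ∫⁻ z in A, ‖M (P z)‖ₑ ∂(Measure.hausdorffMeasure (m : ℝ)) :=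
        lintegral_map hMm hP.continuous.measurable
    _ ≤ ∫⁻ z in A, ‖g z‖ₑ ∂(Measure.hausdorffMeasure (m : ℝ)) :=
        setLIntegral_mono' hA fun z hz => hz.2
    _ ≤ ∫⁻ z in frontier D, ‖g z‖ₑ ∂(Measure.hausdorffMeasure (m : ℝ)) :=
        lintegral_mono_set fun z hz => hz.1

end TraceInequality

/-! ### Cones of inward directions. -/

section Cone

/-- Within the ball `B_r(x)`, the set `D` is closed under moving in direction `ξ`. -/
def IsUpwardIn (D : Set (EuclideanSpace ℝ (Fin n))) (x : EuclideanSpace ℝ (Fin n)) (r : ℝ)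
    (ξ : EuclideanSpace ℝ (Fin n)) : Prop :=
  ∀ y ∈ D, y ∈ Metric.ball x r → ∀ t > (0 : ℝ), y + t • ξ ∈ Metric.ball x r → y + t • ξ ∈ D

lemma norm_sub_inner_smul_le {e : EuclideanSpace ℝ (Fin n)} (he : ‖e‖ = 1)
    (z : EuclideanSpace ℝ (Fin n)) : ‖z - inner ℝ e z • e‖ ≤ 2 * ‖z‖ := by
  calc ‖z - inner ℝ e z • e‖ ≤ ‖z‖ + ‖inner ℝ e z • e‖ := norm_sub_le _ _
    _ = ‖z‖ + |inner ℝ e z| := by rw [norm_smul, he, mul_one, Real.norm_eq_abs]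
    _ ≤ ‖z‖ + ‖e‖ * ‖z‖ := by gcongr; exact abs_real_inner_le_norm e z
    _ = 2 * ‖z‖ := by rw [he]; ring

/-- A `C¹` domain satisfies a uniform cone condition near every point. -/
lemma HasC1Boundary.exists_cone {D : Set (EuclideanSpace ℝ (Fin n))} (hDo : IsOpen D)
    (hD : HasC1Boundary D) (x : EuclideanSpace ℝ (Fin n)) :
    ∃ r > 0, ∃ e : EuclideanSpace ℝ (Fin n), ∃ κ > 0,
      ∀ ξ, ‖ξ - e‖ < κ → IsUpwardIn D x r ξ := by
  by_cases hx : x ∈ frontier D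
  · obtain ⟨r, hr, e, he, γ, hγ, hyD⟩ := hD x hx
    let p : EuclideanSpace ℝ (Fin n) → EuclideanSpace ℝ (Fin n) := fun y => y - inner ℝ e y • e
    have hp : Continuous p := by fun_prop
    obtain ⟨K, s, hs, hK⟩ := (hγ.contDiffAt (x := p x)).exists_lipschitzOnWith
    obtain ⟨δ, hδ, hball⟩ := Metric.mem_nhds_iff.mp (hp.continuousAt.preimage_mem_nhds hs)
    have hK0 : (0 : ℝ) ≤ K := K.2
    -- Moving by `t • ξ` raises the height `⟨e, y⟩` by at least `t(1 - ‖ξ - e‖)` and the graph by at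
    -- most `2Kt‖ξ - e‖`. The first is at least the second when `‖ξ - e‖ (2K + 1) < 1`.
    refine ⟨min r δ, lt_min hr hδ, e, 1 / (2 * K + 1), by positivity, ?_⟩
    intro ξ hξ y hy hyb t ht hyt
    have hb : ∀ z ∈ Metric.ball x (min r δ), z ∈ Metric.ball x r ∧ p z ∈ s := fun z hz =>
      ⟨Metric.ball_subset_ball (min_le_left _ _) hz,
        hball (Metric.ball_subset_ball (min_le_right _ _) hz)⟩
    have h1 := (hyD y (hb y hyb).1).mp hy
    refine (hyD _ (hb _ hyt).1).mpr ?_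
    have hee : inner ℝ e e = (1 : ℝ) := by rw [real_inner_self_eq_norm_sq, he]; norm_num
    have hpd : p (y + t • ξ) - p y = t • ((ξ - e) - inner ℝ e (ξ - e) • e) := by
      simp only [p, inner_add_right, inner_smul_right, inner_sub_right, hee]
      module
    have h2 : γ (p (y + t • ξ)) - γ (p y) ≤ K * (t * (2 * ‖ξ - e‖)) := by
      have h3 := hK.dist_le_mul _ (hb _ hyt).2 _ (hb y hyb).2
      rw [dist_eq_norm, dist_eq_norm, hpd, norm_smul, Real.norm_of_nonneg ht.le] at h3
      refine (le_abs_self _).trans (h3.trans ?_)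
      gcongr
      exact norm_sub_inner_smul_le he _
    have h4 : inner ℝ e (y + t • ξ) = inner ℝ e y + t * (1 + inner ℝ e (ξ - e)) := by
      simp only [inner_add_right, inner_smul_right, inner_sub_right, hee]
      ring
    have h5 : -‖ξ - e‖ ≤ inner ℝ e (ξ - e) := by
      have := abs_real_inner_le_norm e (ξ - e)
      rw [he, one_mul] at this
      exact (abs_le.mp this).1
    have h6 : ‖ξ - e‖ * (2 * K + 1) < 1 := (lt_div_iff₀ (by positivity)).mp hξ
    change γ (p (y + t • ξ)) < _
    rw [h4]
    change γ (p y) < _ at h1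
    have h7 : 0 ≤ t * (1 + inner ℝ e (ξ - e) - 2 * K * ‖ξ - e‖) :=
      mul_nonneg ht.le (by linarith)
    linarith
  -- Away from the boundary a small ball lies inside `D` or misses it, so every direction is
  -- admissible.
  · by_cases hxD : x ∈ D
    · obtain ⟨r, hr, hb⟩ := Metric.isOpen_iff.mp hDo x hxD
      exact ⟨r, hr, 0, 1, one_pos, fun ξ _ y _ _ t _ hyt => hb hyt⟩
    · have hxc : x ∉ closure D := fun hc => hx (by rw [hDo.frontier_eq]; exact ⟨hc, hxD⟩)
      obtain ⟨r, hr, hb⟩ := Metric.isOpen_iff.mp isClosed_closure.isOpen_compl x hxc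
      exact ⟨r, hr, 0, 1, one_pos, fun ξ _ y hy hyb => absurd (subset_closure hy) (hb hyb)⟩

/-- The trace inequality for arbitrary directions. -/
lemma IsUpwardIn.enorm_setIntegral_fderiv_le (hn : n ≠ 0) {D : Set (EuclideanSpace ℝ (Fin n))}
    (hD : IsOpen D) {ξ x : EuclideanSpace ℝ (Fin n)} {r : ℝ} (hup : IsUpwardIn D x r ξ)
    {g : EuclideanSpace ℝ (Fin n) → ℝ} (hg : ContDiff ℝ 1 g)
    (hgs : tsupport g ⊆ Metric.ball x r) :
    ‖∫ y in D, fderiv ℝ g y ξ‖ₑ ≤ ‖ξ‖ₑ * ∫⁻ y, ‖g y‖ₑ ∂(surfaceMeasure D) := by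
  obtain ⟨m, rfl⟩ := Nat.exists_eq_succ_of_ne_zero hn
  rcases eq_or_ne ξ 0 with rfl | hξ
  · simp
  have hξ0 : 0 < ‖ξ‖ := norm_pos_iff.mpr hξ
  have hθ : ‖(‖ξ‖⁻¹ • ξ)‖ = 1 := by
    rw [norm_smul, norm_inv, norm_norm, inv_mul_cancel₀ hξ0.ne']
  have hξθ : ξ = ‖ξ‖ • (‖ξ‖⁻¹ • ξ) := by
    rw [smul_smul, mul_inv_cancel₀ hξ0.ne', one_smul]
  have key := enorm_setIntegral_fderiv_le_of_upward hD hθ (x := x) (r := r)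
    (fun y hy hyb t ht => by
      rw [smul_smul]
      exact hup y hy hyb (t * ‖ξ‖⁻¹) (by positivity)) hg hgs
  have hint : ∫ y in D, fderiv ℝ g y ξ = ‖ξ‖ * ∫ y in D, fderiv ℝ g y (‖ξ‖⁻¹ • ξ) := by
    rw [← integral_const_mul]
    congr 1
    funext y
    rw [← smul_eq_mul, ← map_smul, ← hξθ]
  rw [hint, enorm_mul, enorm_norm]
  refine mul_le_mul_right (key.trans (le_of_eq ?_)) _
  unfold surfaceMeasure
  congr 3
  push_cast
  ring

end Cone

/-! ### Localization to balls. -/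

section PartitionOfUnity

/-- Smooth partitions of unity on a compact set, subordinate to a choice of balls. -/
lemma exists_smooth_partition {K : Set (EuclideanSpace ℝ (Fin n))} (hK : IsCompact K)
    {r : EuclideanSpace ℝ (Fin n) → ℝ} (hr : ∀ x, 0 < r x) :
    ∃ (t : Finset (EuclideanSpace ℝ (Fin n)))
      (χ : t → EuclideanSpace ℝ (Fin n) → ℝ),
      (∀ i, ContDiff ℝ ∞ (χ i)) ∧ (∀ i, tsupport (χ i) ⊆ Metric.ball (i : EuclideanSpace ℝ (Fin n)) (r i)) ∧
      (∀ i x, 0 ≤ χ i x) ∧ ∀ x ∈ K, ∑ i, χ i x = 1 := by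
  obtain ⟨t, -, ht⟩ := hK.elim_nhds_subcover (fun x => Metric.ball x (r x))
    fun x _ => Metric.ball_mem_nhds x (hr x)
  obtain ⟨f, hf⟩ := SmoothPartitionOfUnity.exists_isSubordinate
    (modelWithCornersSelf ℝ (EuclideanSpace ℝ (Fin n))) hK.isClosed
    (fun i : t => Metric.ball (i : EuclideanSpace ℝ (Fin n)) (r i)) (fun _ => Metric.isOpen_ball)
    (by simpa [iUnion_subtype] using ht)
  refine ⟨t, fun i => f i, fun i => (f i).contMDiff.contDiff, hf, fun i x => f.nonneg i x, ?_⟩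
  intro x hx
  rw [← finsum_eq_sum_of_fintype]
  exact f.sum_eq_one hx

end PartitionOfUnity

/-! ### Extension by zero of truncations with nonpositive trace. -/

section ZeroExtension

/-- The extension of `f` by zero outside `D` is weakly differentiable on the whole space, and its
gradient is the extension of `G` by zero. -/
def HasZeroExtension (D : Set (EuclideanSpace ℝ (Fin n))) (f : EuclideanSpace ℝ (Fin n) → ℝ)
    (G : EuclideanSpace ℝ (Fin n) → EuclideanSpace ℝ (Fin n)) : Prop :=
  ∀ ψ : EuclideanSpace ℝ (Fin n) → ℝ, ContDiff ℝ ∞ ψ → HasCompactSupport ψ → ∀ a,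
    ∫ x in D, (f x * fderiv ℝ ψ x a + inner ℝ (G x) a * ψ x) = 0

/-- `w`, with weak gradient `G`, has a trace on `∂D` which is at most `0`. -/
def HasNonposTrace (D : Set (EuclideanSpace ℝ (Fin n))) (w : EuclideanSpace ℝ (Fin n) → ℝ)
    (G : EuclideanSpace ℝ (Fin n) → EuclideanSpace ℝ (Fin n)) : Prop :=
  ∃ T : EuclideanSpace ℝ (Fin n) → ℝ, (∀ᵐ x ∂(surfaceMeasure D), T x ≤ 0) ∧
    HasTrace D w G T

lemma tendsto_lintegral_enorm_sub_sub {α V : Type*} [MeasurableSpace α] [NormedAddCommGroup V]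
    {μ : Measure α} {a b : ℕ → α → V} {a' b' : α → V}
    (ha : ∀ k, AEStronglyMeasurable (a k) μ) (ha' : AEStronglyMeasurable a' μ)
    (hat : Tendsto (fun k => ∫⁻ x, ‖a k x - a' x‖ₑ ∂μ) atTop (𝓝 0))
    (hbt : Tendsto (fun k => ∫⁻ x, ‖b k x - b' x‖ₑ ∂μ) atTop (𝓝 0)) :
    Tendsto (fun k => ∫⁻ x, ‖(a k x - b k x) - (a' x - b' x)‖ₑ ∂μ) atTop (𝓝 0) := by
  have hsum := hat.add hbt
  rw [add_zero] at hsum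
  refine tendsto_of_tendsto_of_tendsto_of_le_of_le tendsto_const_nhds hsum (fun _ => zero_le)
    fun k => ?_
  have hm : AEMeasurable (fun x => ‖a k x - a' x‖ₑ) μ := ((ha k).sub ha').enorm
  rw [← lintegral_add_left' hm]
  refine lintegral_mono fun x => ?_
  rw [sub_sub_sub_comm]
  exact enorm_sub_le

lemma continuous_gradient {f : EuclideanSpace ℝ (Fin n) → ℝ} (hf : ContDiff ℝ 1 f) :
    Continuous (gradient f) :=
  (InnerProductSpace.toDual ℝ (EuclideanSpace ℝ (Fin n))).symm.continuous.comp
    (hf.continuous_fderiv one_ne_zero)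

lemma TraceLE.hasNonposTrace {D : Set (EuclideanSpace ℝ (Fin n))}
    {u v : EuclideanSpace ℝ (Fin n) → ℝ}
    {Gu Gv : EuclideanSpace ℝ (Fin n) → EuclideanSpace ℝ (Fin n)}
    (hv : AEStronglyMeasurable v (volume.restrict D))
    (hGv : AEStronglyMeasurable Gv (volume.restrict D)) (hT : TraceLE D v Gv u Gu) :
    HasNonposTrace D (fun x => v x - u x) (fun x => Gv x - Gu x) := by
  obtain ⟨Tv, Tu, ⟨hTv, a, ha, hat⟩, ⟨hTu, b, hb, hbt⟩, hle⟩ := hT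
  refine ⟨fun x => Tv x - Tu x, hle.mono fun x hx => sub_nonpos.mpr hx, hTv.sub hTu,
    fun k x => a k x - b k x, fun k => (ha k).sub (hb k), fun R hR => ?_⟩
  obtain ⟨ha1, ha2, ha3⟩ := hat R hR
  obtain ⟨hb1, hb2, hb3⟩ := hbt R hR
  have hle' : volume.restrict (D ∩ Metric.ball (0 : EuclideanSpace ℝ (Fin n)) R) ≤
      volume.restrict D := Measure.restrict_mono inter_subset_left le_rfl
  have hgrad : ∀ k x, gradient (fun x => a k x - b k x) x =
      gradient (a k) x - gradient (b k) x := by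
    intro k x
    unfold gradient
    rw [fderiv_fun_sub ((ha k).differentiable one_ne_zero x)
      ((hb k).differentiable one_ne_zero x), map_sub]
  refine ⟨?_, ?_, ?_⟩
  · exact tendsto_lintegral_enorm_sub_sub
      (fun k => (ha k).continuous.aestronglyMeasurable) (hv.mono_measure hle') ha1 hb1
  · simp_rw [hgrad]
    exact tendsto_lintegral_enorm_sub_sub
      (fun k => (continuous_gradient (ha k)).aestronglyMeasurable) (hGv.mono_measure hle') ha2 hb2
  · exact tendsto_lintegral_enorm_sub_sub
      (fun k => (ha k).continuous.aestronglyMeasurable) hTv.restrict ha3 hb3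

/-- Admissible truncations: bounded `C¹` functions with bounded derivative, vanishing on
`(-∞, 0]`. -/
structure IsTruncation (β : ℝ → ℝ) (L : ℝ) : Prop where
  contDiff : ContDiff ℝ 1 β
  nonneg : ∀ s, 0 ≤ β s
  le_one : ∀ s, β s ≤ 1
  deriv_nonneg : ∀ s, 0 ≤ deriv β s
  deriv_le : ∀ s, deriv β s ≤ L
  eq_zero : ∀ s ≤ 0, β s = 0

lemma IsTruncation.bound_nonneg {β : ℝ → ℝ} {L : ℝ} (hβ : IsTruncation β L) : 0 ≤ L :=
  (hβ.deriv_nonneg 0).trans (hβ.deriv_le 0)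

lemma IsTruncation.abs_deriv_le {β : ℝ → ℝ} {L : ℝ} (hβ : IsTruncation β L) (s : ℝ) :
    |deriv β s| ≤ L := by
  rw [abs_of_nonneg (hβ.deriv_nonneg s)]
  exact hβ.deriv_le s

lemma IsTruncation.continuous_deriv {β : ℝ → ℝ} {L : ℝ} (hβ : IsTruncation β L) :
    Continuous (deriv β) :=
  hβ.contDiff.continuous_deriv le_rfl

lemma IsTruncation.abs_le {β : ℝ → ℝ} {L : ℝ} (hβ : IsTruncation β L) (s : ℝ) : |β s| ≤ 1 := by
  rw [abs_of_nonneg (hβ.nonneg s)]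
  exact hβ.le_one s

/-- The truncation is controlled by the distance to any nonpositive number. -/
lemma IsTruncation.abs_le_mul {β : ℝ → ℝ} {L : ℝ} (hβ : IsTruncation β L) (s : ℝ) {t : ℝ}
    (ht : t ≤ 0) : |β s| ≤ L * |s - t| := by
  have h1 := Convex.norm_image_sub_le_of_norm_deriv_le (f := β) (s := univ) (C := L) (x := t)
    (y := s) (fun x _ => (hβ.contDiff.differentiable one_ne_zero) x)
    (fun x _ => hβ.abs_deriv_le x) convex_univ (mem_univ _) (mem_univ _)
  rwa [hβ.eq_zero t ht, sub_zero] at h1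

variable {D : Set (EuclideanSpace ℝ (Fin n))} {w : EuclideanSpace ℝ (Fin n) → ℝ}
  {G : EuclideanSpace ℝ (Fin n) → EuclideanSpace ℝ (Fin n)} {β : ℝ → ℝ} {L : ℝ}

/-- Truncations of a function with nonpositive trace: the weak identity, for test functions
supported in a ball where `D` is upward closed in the direction of differentiation. -/
lemma HasNonposTrace.setIntegral_eq_zero_of_upward (hn : n ≠ 0) (hD : IsOpen D)
    (hw : AEStronglyMeasurable w (volume.restrict D))
    (hGi : ∀ R, IntegrableOn G (D ∩ Metric.ball 0 R))
    (hT : HasNonposTrace D w G) (hβ : IsTruncation β L)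
    {x ξ : EuclideanSpace ℝ (Fin n)} {r : ℝ} (hup : IsUpwardIn D x r ξ)
    {ψ : EuclideanSpace ℝ (Fin n) → ℝ} (hψ : ContDiff ℝ 1 ψ)
    (hψs : tsupport ψ ⊆ Metric.ball x r) :
    ∫ y in D, (β (w y) * fderiv ℝ ψ y ξ + inner ℝ (deriv β (w y) • G y) ξ * ψ y) = 0 := by
  obtain ⟨T, hT0, hTm, z, hz, hzR⟩ := hT
  obtain ⟨R, hR, hball⟩ : ∃ R > 0, Metric.ball x r ⊆ Metric.ball 0 R := by
    refine ⟨‖x‖ + |r| + 1, by positivity, Metric.ball_subset_ball' ?_⟩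
    rw [dist_zero_right]
    linarith [le_abs_self r]
  obtain ⟨h1, h2, h3⟩ := hzR R hR
  have hψc : HasCompactSupport ψ :=
    HasCompactSupport.of_support_subset_isCompact (isCompact_closedBall x r)
      ((subset_tsupport ψ).trans (hψs.trans Metric.ball_subset_closedBall))
  set μ := volume.restrict (D ∩ Metric.ball (0 : EuclideanSpace ℝ (Fin n)) R) with hμ
  have hμD : μ ≤ volume.restrict D := Measure.restrict_mono inter_subset_left le_rfl
  have hψ0 : ∀ y, y ∉ Metric.ball (0 : EuclideanSpace ℝ (Fin n)) R → ψ y = 0 := fun y hy => by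
    by_contra hcon
    exact hy (hball (hψs (subset_tsupport ψ hcon)))
  have hdψ0 : ∀ y, y ∉ Metric.ball (0 : EuclideanSpace ℝ (Fin n)) R → fderiv ℝ ψ y = 0 :=
    fun y hy => by
    by_contra hcon
    exact hy (hball (hψs (support_fderiv_subset ℝ hcon)))
  -- restriction of the integrals to the ball
  have hres : ∀ F : EuclideanSpace ℝ (Fin n) → ℝ,
      (∀ y, y ∉ Metric.ball (0 : EuclideanSpace ℝ (Fin n)) R → F y = 0) →
      ∫ y in D, F y = ∫ y, F y ∂μ := by
    intro F hF
    refine setIntegral_eq_of_subset_of_forall_sdiff_eq_zero hD.measurableSet inter_subset_left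
      fun y hy => hF y fun hyb => hy.2 ⟨hy.1, hyb⟩
  -- almost everywhere convergence along a subsequence
  have hzw : TendstoInMeasure μ z atTop w := by
    refine tendstoInMeasure_of_tendsto_eLpNorm one_ne_zero
      (fun k => (hz k).continuous.aestronglyMeasurable) (hw.mono_measure hμD) ?_
    simp_rw [eLpNorm_one_eq_lintegral_enorm]
    exact h1
  obtain ⟨ns, hns, hae⟩ := hzw.exists_seq_tendsto_ae
  obtain ⟨C, hC⟩ := hψc.exists_bound_of_continuous hψ.continuous
  have hC0 : 0 ≤ C := (norm_nonneg _).trans (hC x)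
  have hdψ : Continuous fun y => fderiv ℝ ψ y ξ :=
    (hψ.continuous_fderiv one_ne_zero).clm_apply continuous_const
  have hdψi : Integrable (fun y => fderiv ℝ ψ y ξ) μ :=
    (hdψ.integrable_of_hasCompactSupport (hψc.fderiv_apply ℝ ξ)).restrict
  have hGμ : Integrable G μ := hGi R
  have hGξ : Integrable (fun y => inner ℝ (G y) ξ) μ := hGμ.inner_const ξ
  have hGξψ : Integrable (fun y => inner ℝ (G y) ξ * ψ y) μ :=
    hGξ.mul_bdd (c := C) hψ.continuous.aestronglyMeasurable (ae_of_all _ hC)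
  have hI : Tendsto (fun k => ∫ y, β (z (ns k) y) * fderiv ℝ ψ y ξ ∂μ) atTop
      (𝓝 (∫ y, β (w y) * fderiv ℝ ψ y ξ ∂μ)) := by
    refine tendsto_integral_of_dominated_convergence (fun y => ‖fderiv ℝ ψ y ξ‖)
      (fun k => ((hβ.contDiff.continuous.comp (hz _).continuous).mul hdψ).aestronglyMeasurable)
      hdψi.norm (fun k => ae_of_all _ fun y => ?_) (hae.mono fun y hy => ?_)
    · rw [norm_mul]
      exact mul_le_of_le_one_left (norm_nonneg _) (hβ.abs_le _)
    · exact ((hβ.contDiff.continuous.tendsto _).comp hy).mul_const _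
  have hII : Tendsto (fun k => ∫ y, deriv β (z (ns k) y) * (inner ℝ (G y) ξ * ψ y) ∂μ) atTop
      (𝓝 (∫ y, deriv β (w y) * (inner ℝ (G y) ξ * ψ y) ∂μ)) := by
    refine tendsto_integral_of_dominated_convergence (fun y => L * ‖inner ℝ (G y) ξ * ψ y‖)
      (fun k => (hβ.continuous_deriv.comp (hz _).continuous).aestronglyMeasurable.mul
        hGξψ.aestronglyMeasurable)
      (hGξψ.norm.const_mul L) (fun k => ae_of_all _ fun y => ?_) (hae.mono fun y hy => ?_)
    · rw [norm_mul]
      exact mul_le_mul_of_nonneg_right (hβ.abs_deriv_le _) (norm_nonneg _)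
    · exact ((hβ.continuous_deriv.tendsto _).comp hy).mul_const _
  -- The gradients converge only in `L¹`, which suffices because `β'` and `ψ` are bounded.
  have hIII : Tendsto (fun k => ∫ y, deriv β (z (ns k) y) *
      (inner ℝ (gradient (z (ns k)) y - G y) ξ * ψ y) ∂μ) atTop (𝓝 0) := by
    rw [tendsto_zero_iff_enorm_tendsto_zero]
    have hlim : Tendsto (fun k => ENNReal.ofReal (L * ‖ξ‖ * C) *
        ∫⁻ y, ‖gradient (z (ns k)) y - G y‖ₑ ∂μ) atTop (𝓝 0) := by
      have := ENNReal.Tendsto.const_mul (a := ENNReal.ofReal (L * ‖ξ‖ * C))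
        (h2.comp hns.tendsto_atTop) (Or.inr ENNReal.ofReal_ne_top)
      rwa [mul_zero] at this
    refine tendsto_of_tendsto_of_tendsto_of_le_of_le tendsto_const_nhds hlim (fun _ => zero_le)
      fun k => (enorm_integral_le_lintegral_enorm _).trans ?_
    rw [← lintegral_const_mul' _ _ ENNReal.ofReal_ne_top]
    refine lintegral_mono fun y => ?_
    rw [← ofReal_norm, ← ofReal_norm, ← ENNReal.ofReal_mul
      (mul_nonneg (mul_nonneg hβ.bound_nonneg (norm_nonneg _)) hC0)]
    refine ENNReal.ofReal_le_ofReal ?_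
    rw [norm_mul, norm_mul]
    calc ‖deriv β (z (ns k) y)‖ * (‖inner ℝ (gradient (z (ns k)) y - G y) ξ‖ * ‖ψ y‖)
        ≤ L * ((‖gradient (z (ns k)) y - G y‖ * ‖ξ‖) * C) := by
          gcongr
          · exact hβ.bound_nonneg
          · exact hβ.abs_deriv_le _
          · exact norm_inner_le_norm _ _
          · exact hC y
      _ = L * ‖ξ‖ * C * ‖gradient (z (ns k)) y - G y‖ := by ring
  -- the approximate identities
  let g : ℕ → EuclideanSpace ℝ (Fin n) → ℝ := fun k y => β (z k y) * ψ y
  have hg : ∀ k, ContDiff ℝ 1 (g k) := fun k => (hβ.contDiff.comp (hz k)).mul hψ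
  have hgs : ∀ k, tsupport (g k) ⊆ Metric.ball x r := fun k =>
    (tsupport_mul_subset_right (f := fun y => β (z k y)) (g := ψ)).trans hψs
  have hgder : ∀ k y, fderiv ℝ (g k) y ξ = β (z k y) * fderiv ℝ ψ y ξ +
      (deriv β (z k y) * (inner ℝ (G y) ξ * ψ y) +
        deriv β (z k y) * (inner ℝ (gradient (z k) y - G y) ξ * ψ y)) := by
    intro k y
    have hd1 : HasFDerivAt (fun y => β (z k y)) (deriv β (z k y) • fderiv ℝ (z k) y) y :=
      ((hβ.contDiff.differentiable one_ne_zero) _).hasDerivAt.comp_hasFDerivAt y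
        ((hz k).differentiable one_ne_zero y).hasFDerivAt
    have hd2 := (hψ.differentiable one_ne_zero y).hasFDerivAt
    have hd3 : HasFDerivAt (g k) _ y := hd1.mul hd2
    rw [hd3.fderiv]
    simp only [add_apply, smul_apply, smul_eq_mul,
      inner_sub_left, inner_gradient_left]
    ring
  -- The trace inequality applies to `g`. On `∂D` one has `|β(z_k)| ≤ L|z_k - T|` because `T ≤ 0`,
  -- so the surface integrals tend to `0`.
  have hA : Tendsto (fun k => ∫ y in D, fderiv ℝ (g (ns k)) y ξ) atTop (𝓝 0) := by
    rw [tendsto_zero_iff_enorm_tendsto_zero]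
    have hlim : Tendsto (fun k => ‖ξ‖ₑ * (ENNReal.ofReal (L * C) *
        ∫⁻ y in Metric.ball 0 R, ‖z (ns k) y - T y‖ₑ ∂(surfaceMeasure D))) atTop (𝓝 0) := by
      have := ENNReal.Tendsto.const_mul (a := ‖ξ‖ₑ) (ENNReal.Tendsto.const_mul
        (a := ENNReal.ofReal (L * C))
        (h3.comp hns.tendsto_atTop) (Or.inr ENNReal.ofReal_ne_top)) (Or.inr enorm_ne_top)
      rwa [mul_zero, mul_zero] at this
    refine tendsto_of_tendsto_of_tendsto_of_le_of_le tendsto_const_nhds hlim (fun _ => zero_le)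
      fun k => (hup.enorm_setIntegral_fderiv_le hn hD (hg _) (hgs _)).trans ?_
    refine mul_le_mul_right ?_ _
    rw [← lintegral_const_mul' _ _ ENNReal.ofReal_ne_top,
      ← lintegral_indicator Metric.isOpen_ball.measurableSet]
    refine lintegral_mono_ae (hT0.mono fun y hy => ?_)
    by_cases hyb : y ∈ Metric.ball (0 : EuclideanSpace ℝ (Fin n)) R
    · rw [indicator_of_mem hyb, ← ofReal_norm, ← ofReal_norm, ← ENNReal.ofReal_mul
        (mul_nonneg hβ.bound_nonneg hC0)]
      refine ENNReal.ofReal_le_ofReal ?_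
      simp only [g]
      rw [norm_mul]
      calc ‖β (z (ns k) y)‖ * ‖ψ y‖ ≤ (L * |z (ns k) y - T y|) * C :=
            mul_le_mul (hβ.abs_le_mul _ hy) (hC y) (norm_nonneg _)
              (mul_nonneg hβ.bound_nonneg (abs_nonneg _))
        _ = L * C * ‖z (ns k) y - T y‖ := by rw [Real.norm_eq_abs]; ring
    · simp [g, hψ0 y hyb]
  have hint1 : ∀ f : EuclideanSpace ℝ (Fin n) → ℝ, AEStronglyMeasurable f μ →
      Integrable (fun y => β (f y) * fderiv ℝ ψ y ξ) μ := fun f hf =>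
    hdψi.bdd_mul (c := 1) (hβ.contDiff.continuous.comp_aestronglyMeasurable hf)
      (ae_of_all _ fun y => hβ.abs_le _)
  have hint2 : ∀ f : EuclideanSpace ℝ (Fin n) → ℝ, AEStronglyMeasurable f μ →
      Integrable (fun y => deriv β (f y) * (inner ℝ (G y) ξ * ψ y)) μ := fun f hf =>
    hGξψ.bdd_mul (c := L) (hβ.continuous_deriv.comp_aestronglyMeasurable hf)
      (ae_of_all _ fun y => hβ.abs_deriv_le _)
  have hgi : ∀ k, Integrable (fun y => fderiv ℝ (g k) y ξ) μ := fun k => by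
    have hc : HasCompactSupport (g k) := hψc.mul_left
    exact ((((hg k).continuous_fderiv one_ne_zero).clm_apply
      continuous_const).integrable_of_hasCompactSupport (hc.fderiv_apply ℝ ξ)).restrict
  have hsplit : ∀ k, ∫ y in D, fderiv ℝ (g k) y ξ = ∫ y, β (z k y) * fderiv ℝ ψ y ξ ∂μ +
      (∫ y, deriv β (z k y) * (inner ℝ (G y) ξ * ψ y) ∂μ +
      ∫ y, deriv β (z k y) * (inner ℝ (gradient (z k) y - G y) ξ * ψ y) ∂μ) := by
    intro k
    have i1 := hint1 (z k) (hz k).continuous.aestronglyMeasurable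
    have i2 := hint2 (z k) (hz k).continuous.aestronglyMeasurable
    have i3 : Integrable (fun y => deriv β (z k y) *
        (inner ℝ (gradient (z k) y - G y) ξ * ψ y)) μ := by
      have := ((hgi k).sub i1).sub i2
      refine this.congr (ae_of_all _ fun y => ?_)
      simp only [Pi.sub_apply, hgder]
      ring
    rw [hres _ fun y hy => by simp [hgder, hψ0 y hy, hdψ0 y hy]]
    simp_rw [hgder]
    have i23 : Integrable (fun y => deriv β (z k y) * (inner ℝ (G y) ξ * ψ y) +
        deriv β (z k y) * (inner ℝ (gradient (z k) y - G y) ξ * ψ y)) μ := i2.add i3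
    rw [integral_add i1 i23, integral_add i2 i3]
  have hlim := hI.add (hII.add hIII)
  simp_rw [← fun k => hsplit (ns k)] at hlim
  have heq := tendsto_nhds_unique hlim hA
  rw [add_zero] at heq
  have hwμ := hw.mono_measure hμD
  rw [hres _ fun y hy => by simp [hψ0 y hy, hdψ0 y hy], ← heq,
    ← integral_add (hint1 w hwμ) (hint2 w hwμ)]
  congr 1
  funext y
  rw [real_inner_smul_left]
  ring

/-- Integrability of the integrand of the weak identity. -/
lemma integrableOn_zeroExtension_integrand {f : EuclideanSpace ℝ (Fin n) → ℝ} (hD : IsOpen D)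
    (hf : AEStronglyMeasurable f (volume.restrict D)) (hfb : ∀ x, |f x| ≤ 1)
    (hGi : ∀ R, IntegrableOn G (D ∩ Metric.ball 0 R))
    {ψ : EuclideanSpace ℝ (Fin n) → ℝ} (hψ : ContDiff ℝ 1 ψ) (hψc : HasCompactSupport ψ)
    (a : EuclideanSpace ℝ (Fin n)) :
    IntegrableOn (fun x => f x * fderiv ℝ ψ x a + inner ℝ (G x) a * ψ x) D := by
  obtain ⟨C, hC⟩ := hψc.exists_bound_of_continuous hψ.continuous
  obtain ⟨R, hR⟩ := hψc.isCompact.isBounded.subset_ball (0 : EuclideanSpace ℝ (Fin n))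
  have hdψ : Continuous fun y => fderiv ℝ ψ y a :=
    (hψ.continuous_fderiv one_ne_zero).clm_apply continuous_const
  have h1 : IntegrableOn (fun x => f x * fderiv ℝ ψ x a) D :=
    ((hdψ.integrable_of_hasCompactSupport (hψc.fderiv_apply ℝ a)).restrict).bdd_mul (c := 1) hf
      (ae_of_all _ hfb)
  have h2 : IntegrableOn (fun x => inner ℝ (G x) a * ψ x) (D ∩ Metric.ball 0 R) :=
    Integrable.mul_bdd (c := C) (Integrable.inner_const (hGi R) a)
      hψ.continuous.aestronglyMeasurable (ae_of_all _ hC)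
  refine Integrable.add h1 (h2.of_forall_sdiff_eq_zero hD.measurableSet fun x hx => ?_)
  have : ψ x = 0 := by
    by_contra hcon
    exact hx.2 ⟨hx.1, hR (subset_tsupport ψ hcon)⟩
  rw [this, mul_zero]

/-- Truncations of a function with nonpositive trace extend by zero as weakly differentiable
functions. -/
lemma HasNonposTrace.hasZeroExtension (hn : n ≠ 0) (hD : IsOpen D) (hD1 : HasC1Boundary D)
    (hw : AEStronglyMeasurable w (volume.restrict D))
    (hGi : ∀ R, IntegrableOn G (D ∩ Metric.ball 0 R))
    (hT : HasNonposTrace D w G) (hβ : IsTruncation β L) :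
    HasZeroExtension D (fun x => β (w x)) (fun x => deriv β (w x) • G x) := by
  intro ψ hψ hψc a
  have hψ1 : ContDiff ℝ 1 ψ := hψ.of_le (by exact_mod_cast le_top)
  have hβw : AEStronglyMeasurable (fun x => β (w x)) (volume.restrict D) :=
    hβ.contDiff.continuous.comp_aestronglyMeasurable hw
  have hβG : ∀ R, IntegrableOn (fun x => deriv β (w x) • G x) (D ∩ Metric.ball 0 R) := fun R =>
    Integrable.bdd_smul (C := L) (hGi R)
      ((hβ.continuous_deriv.comp_aestronglyMeasurable hw).mono_measure
        (Measure.restrict_mono inter_subset_left le_rfl)) (ae_of_all _ fun x => hβ.abs_deriv_le _)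
  have hint := fun (φ : EuclideanSpace ℝ (Fin n) → ℝ) (hφ : ContDiff ℝ 1 φ)
    (hφc : HasCompactSupport φ) (b : EuclideanSpace ℝ (Fin n)) =>
    integrableOn_zeroExtension_integrand hD hβw (fun x => hβ.abs_le _) hβG hφ hφc b
  choose r hr e κ hκ hcone using hD1.exists_cone hD
  obtain ⟨t, χ, hχ, hχs, -, hχ1⟩ := exists_smooth_partition hψc.isCompact hr
  have hχ' : ∀ i, ContDiff ℝ 1 (χ i) := fun i => (hχ i).of_le (by exact_mod_cast le_top)
  have hloc : ∀ i, ∫ x in D, (β (w x) * fderiv ℝ (fun y => χ i y * ψ y) x a +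
      inner ℝ (deriv β (w x) • G x) a * (χ i x * ψ x)) = 0 := by
    intro i
    have hφ : ContDiff ℝ 1 fun y => χ i y * ψ y := (hχ' i).mul hψ1
    have hφc : HasCompactSupport fun y => χ i y * ψ y := hψc.mul_left
    have hφs : tsupport (fun y => χ i y * ψ y) ⊆ Metric.ball (i : EuclideanSpace ℝ (Fin n)) (r i) :=
      (tsupport_mul_subset_left (f := χ i) (g := ψ)).trans (hχs i)
    have hdir : ∀ ξ, ‖ξ - e i‖ < κ i → _ := fun ξ hξ =>
      hT.setIntegral_eq_zero_of_upward hn hD hw hGi hβ (hcone i ξ hξ) hφ hφs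
    -- The cone is open, so it contains both `e i` and `e i + s • a`. The identity is linear in the
    -- direction, and subtracting the two instances yields it for arbitrary `a`.
    obtain ⟨s, hs, hsa⟩ : ∃ s > 0, s * ‖a‖ < κ i := by
      refine ⟨κ i / (‖a‖ + 1), div_pos (hκ i) (by positivity), ?_⟩
      rw [div_mul_eq_mul_div, div_lt_iff₀ (by positivity)]
      nlinarith [hκ i]
    have h1 := hdir (e i) (by simpa using hκ i)
    have h2 := hdir (e i + s • a) (by
      rwa [add_sub_cancel_left, norm_smul, Real.norm_of_nonneg hs.le])
    have h3 : ∫ x in D, s * (β (w x) * fderiv ℝ (fun y => χ i y * ψ y) x a +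
        inner ℝ (deriv β (w x) • G x) a * (χ i x * ψ x)) = 0 := by
      refine Eq.trans ?_ ((congrArg₂ (· - ·) h2 h1).trans (sub_zero 0))
      rw [← integral_sub (hint _ hφ hφc _) (hint _ hφ hφc _)]
      congr 1
      funext x
      rw [map_add, map_smul, inner_add_right, inner_smul_right, smul_eq_mul]
      ring
    rw [integral_const_mul] at h3
    exact (mul_eq_zero.mp h3).resolve_left hs.ne'
  have hsum : ∀ x, ∑ i, χ i x * ψ x = ψ x := by
    intro x
    rw [← Finset.sum_mul]
    by_cases hx : x ∈ tsupport ψ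
    · rw [hχ1 x hx, one_mul]
    · rw [image_eq_zero_of_notMem_tsupport hx, mul_zero]
  have hdsum : ∀ x, ∑ i, fderiv ℝ (fun y => χ i y * ψ y) x a = fderiv ℝ ψ x a := by
    intro x
    have h1 : (fun y => ∑ i, χ i y * ψ y) = ψ := funext hsum
    rw [← sum_apply, ← fderiv_fun_sum fun i _ =>
      ((hχ' i).mul hψ1).differentiable one_ne_zero x, h1]
  have hfin : ∫ x in D, ∑ i, (β (w x) * fderiv ℝ (fun y => χ i y * ψ y) x a +
      inner ℝ (deriv β (w x) • G x) a * (χ i x * ψ x)) = 0 := by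
    rw [integral_finsetSum _ fun i _ => hint _ ((hχ' i).mul hψ1) hψc.mul_left _]
    exact Finset.sum_eq_zero fun i _ => hloc i
  rw [← hfin]
  congr 1
  funext x
  rw [Finset.sum_add_distrib, ← Finset.mul_sum, ← Finset.mul_sum, hsum, hdsum]

end ZeroExtension

/-! ### Stability of finite energy and local integrability. -/

section FiniteEnergy

variable {h : ℝ → ℝ} {D : Set (EuclideanSpace ℝ (Fin n))}
  {G G₁ G₂ : EuclideanSpace ℝ (Fin n) → EuclideanSpace ℝ (Fin n)}

/-- The sum is at most three times its largest term, and `s ↦ s h(s)` is increasing. -/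
lemma IsProfile.mul_add_le (hh : IsProfile h) {a b c t : ℝ} (ht0 : 0 ≤ t) (ha : 0 ≤ a) (hb : 0 ≤ b)
    (hc : 0 ≤ c) (ht : t ≤ a + b + c) :
    t * h t ≤ 3 * a * h (3 * a) + 3 * b * h (3 * b) + 3 * c * h (3 * c) := by
  have h1 := hh.mul_nonneg (t := 3 * a) (by positivity)
  have h2 := hh.mul_nonneg (t := 3 * b) (by positivity)
  have h3 := hh.mul_nonneg (t := 3 * c) (by positivity)
  by_cases hta : t ≤ 3 * a
  · linarith [hh.mul_mono ht0 hta]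
  by_cases htb : t ≤ 3 * b
  · linarith [hh.mul_mono ht0 htb]
  by_cases htc : t ≤ 3 * c
  · linarith [hh.mul_mono ht0 htc]
  linarith

/-- The factors `3` and `b` are absorbed because `HasFiniteEnergy` allows every dilation; the
constant `a` costs a finite amount on a set of finite measure. -/
lemma HasFiniteEnergy.of_norm_le (hh : IsProfile h) (h₁ : HasFiniteEnergy h D G₁)
    (h₂ : HasFiniteEnergy h D G₂) (hm₁ : AEStronglyMeasurable G₁ (volume.restrict D))
    {a b : ℝ} (ha : 0 ≤ a) (hb : 0 ≤ b)
    (hG : ∀ x, ‖G x‖ ≤ a + b * ‖G₁ x‖ + b * ‖G₂ x‖) : HasFiniteEnergy h D G := by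
  intro c hc S hSD hS
  have e1 := h₁ (3 * c * b) (by positivity) S hSD hS
  have e2 := h₂ (3 * c * b) (by positivity) S hSD hS
  have hm : AEMeasurable (fun x => ENNReal.ofReal (3 * c * b * ‖G₁ x‖ * h (3 * c * b * ‖G₁ x‖)))
      (volume.restrict S) := by
    have hm' := hm₁.mono_measure (Measure.restrict_mono hSD le_rfl)
    have h1 : Continuous fun ξ : EuclideanSpace ℝ (Fin n) =>
        3 * c * b * ‖ξ‖ * h (3 * c * b * ‖ξ‖) :=
      (by fun_prop : Continuous fun ξ : EuclideanSpace ℝ (Fin n) => 3 * c * b * ‖ξ‖).mul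
        (hh.continuousOn.comp_continuous (by fun_prop) fun ξ => by
          simp only [mem_Ici]; positivity)
    exact (h1.comp_aestronglyMeasurable hm').aemeasurable.ennreal_ofReal
  refine setLIntegral_lt_top_of_le_add subset_rfl hS (a := 1)
    (b := ENNReal.ofReal (3 * (c * a) * h (3 * (c * a)))) ENNReal.one_ne_top ENNReal.ofReal_ne_top
    (g := fun x => ENNReal.ofReal (3 * c * b * ‖G₁ x‖ * h (3 * c * b * ‖G₁ x‖)) +
      ENNReal.ofReal (3 * c * b * ‖G₂ x‖ * h (3 * c * b * ‖G₂ x‖))) (fun x => ?_) ?_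
  · have p0 := hh.mul_nonneg (t := 3 * (c * a)) (by positivity)
    have p1 := hh.mul_nonneg (t := 3 * c * b * ‖G₁ x‖) (by positivity)
    have p2 := hh.mul_nonneg (t := 3 * c * b * ‖G₂ x‖) (by positivity)
    rw [one_mul, ← ENNReal.ofReal_add p1 p2, ← ENNReal.ofReal_add (add_nonneg p1 p2) p0]
    refine ENNReal.ofReal_le_ofReal ?_
    have := hh.mul_add_le (t := c * ‖G x‖) (a := c * b * ‖G₁ x‖) (b := c * b * ‖G₂ x‖)
      (c := c * a) (by positivity) (by positivity) (by positivity) (by positivity)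
      (by nlinarith [mul_le_mul_of_nonneg_left (hG x) hc])
    rw [← mul_assoc, ← mul_assoc, ← mul_assoc, ← mul_assoc] at this
    exact this
  · rw [lintegral_add_left' hm]
    exact ENNReal.add_lt_top.mpr ⟨e1, e2⟩

lemma HasFiniteEnergy.lintegral_lt_top (hG : HasFiniteEnergy h D G)
    {S : Set (EuclideanSpace ℝ (Fin n))} (hSD : S ⊆ D) (hS : volume S < ⊤) :
    ∫⁻ x in S, ENNReal.ofReal (‖G x‖ * h ‖G x‖) < ⊤ := by
  simpa using hG 1 zero_le_one S hSD hS

lemma HasFiniteEnergy.lintegral_enorm_lt_top (hh : IsProfile h) (hG : HasFiniteEnergy h D G)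
    {S : Set (EuclideanSpace ℝ (Fin n))} (hSD : S ⊆ D) (hS : volume S < ⊤) :
    ∫⁻ x in S, ‖G x‖ₑ < ⊤ := by
  have h1 : 0 < h 1 := hh.pos one_pos
  refine setLIntegral_lt_top_of_le_add subset_rfl hS (a := ENNReal.ofReal (h 1)⁻¹) (b := 1)
    ENNReal.ofReal_ne_top ENNReal.one_ne_top (fun x => ?_) (hG.lintegral_lt_top hSD hS)
  rw [← ofReal_norm, ← ENNReal.ofReal_mul (by positivity), ← ENNReal.ofReal_one,
    ← ENNReal.ofReal_add (mul_nonneg (by positivity) (hh.mul_nonneg (norm_nonneg _))) zero_le_one]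
  refine ENNReal.ofReal_le_ofReal ?_
  rcases le_total ‖G x‖ 1 with hx | hx
  · have := mul_nonneg (inv_nonneg.mpr h1.le) (hh.mul_nonneg (norm_nonneg (G x)))
    linarith
  · have h2 := hh.mono zero_le_one hx
    have h3 : ‖G x‖ ≤ (h 1)⁻¹ * (‖G x‖ * h ‖G x‖) := by
      rw [inv_mul_eq_div, le_div_iff₀ h1]
      exact mul_le_mul_of_nonneg_left h2 (norm_nonneg _)
    linarith

lemma HasFiniteEnergy.lintegral_profile_lt_top (hh : IsProfile h) (hG : HasFiniteEnergy h D G)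
    {S : Set (EuclideanSpace ℝ (Fin n))} (hSD : S ⊆ D) (hS : volume S < ⊤) :
    ∫⁻ x in S, ENNReal.ofReal (h ‖G x‖) < ⊤ := by
  refine setLIntegral_lt_top_of_le_add subset_rfl hS (a := 1) (b := ENNReal.ofReal (h 1))
    ENNReal.one_ne_top ENNReal.ofReal_ne_top (fun x => ?_) (hG.lintegral_lt_top hSD hS)
  rw [one_mul, ← ENNReal.ofReal_add (hh.mul_nonneg (norm_nonneg _)) (hh.nonneg zero_le_one)]
  refine ENNReal.ofReal_le_ofReal ?_
  have h0 := hh.mul_nonneg (norm_nonneg (G x))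
  rcases le_total ‖G x‖ 1 with hx | hx
  · linarith [hh.mono (norm_nonneg _) hx]
  · nlinarith [hh.nonneg zero_le_one, hh.nonneg (norm_nonneg (G x))]

lemma measure_inter_ball_lt_top (D : Set (EuclideanSpace ℝ (Fin n))) (R : ℝ) :
    volume (D ∩ Metric.ball 0 R) < ⊤ :=
  (measure_mono inter_subset_right).trans_lt measure_ball_lt_top

lemma HasFiniteEnergy.integrableOn_ball (hh : IsProfile h) (hG : HasFiniteEnergy h D G)
    (hm : AEStronglyMeasurable G (volume.restrict D)) (R : ℝ) :
    IntegrableOn G (D ∩ Metric.ball 0 R) :=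
  ⟨hm.mono_measure (Measure.restrict_mono inter_subset_left le_rfl),
    hG.lintegral_enorm_lt_top hh inter_subset_left (measure_inter_ball_lt_top D R)⟩

end FiniteEnergy

/-! ### Continuity of translations, first in `L¹`, then with weight `h(|G|)`. -/

section Translation

/-- Continuity of translations in `L¹`. -/
lemma tendsto_lintegral_enorm_translate_sub
    {Q : EuclideanSpace ℝ (Fin n) → EuclideanSpace ℝ (Fin n)} (hQ : Integrable Q) :
    Tendsto (fun ξ => ∫⁻ y, ‖Q (y - ξ) - Q y‖ₑ) (𝓝 0) (𝓝 0) := by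
  have hm : MemLp Q 1 volume := memLp_one_iff_integrable.mpr hQ
  have : Fact ((1 : ENNReal) ≠ ⊤) := ⟨ENNReal.one_ne_top⟩
  have hcont : Continuous fun ξ : EuclideanSpace ℝ (Fin n) =>
      edist (DomAddAct.mk (-ξ) +ᵥ hm.toLp Q) (hm.toLp Q) := by
    refine Continuous.edist ?_ continuous_const
    exact (DomAddAct.continuous_mk.comp continuous_neg).vadd continuous_const
  have h0 := hcont.tendsto 0
  have heq : ∀ ξ : EuclideanSpace ℝ (Fin n),
      edist (DomAddAct.mk (-ξ) +ᵥ hm.toLp Q) (hm.toLp Q) = ∫⁻ y, ‖Q (y - ξ) - Q y‖ₑ := by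
    intro ξ
    rw [DomAddAct.mk_vadd_toLp, Lp.edist_toLp_toLp, eLpNorm_one_eq_lintegral_enorm]
    simp only [vadd_eq_add, Pi.sub_apply, neg_add_eq_sub]
  simp_rw [heq] at h0
  simpa using h0

end Translation

section TranslationEstimate

variable {h : ℝ → ℝ}

/-- The part of `t h(t)` where `t > M`. -/
def tailEnergy (h : ℝ → ℝ) (M t : ℝ) : ℝ := if M < t then t * h t else 0

lemma tailEnergy_nonneg (hh : IsProfile h) (M : ℝ) {t : ℝ} (ht : 0 ≤ t) : 0 ≤ tailEnergy h M t := by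
  unfold tailEnergy
  split_ifs
  · exact hh.mul_nonneg ht
  · exact le_rfl

/-- The larger of `s` and `t` exceeds `M`, so its tail energy is its full energy and already
dominates the mixed product. -/
lemma mul_le_add_tailEnergy (hh : IsProfile h) {M s t : ℝ} (hs : 0 ≤ s) (ht : 0 ≤ t)
    (hM : M < s) : h s * t ≤ tailEnergy h M s + tailEnergy h M t := by
  rcases le_total t s with hts | hts
  · have h1 : tailEnergy h M s = s * h s := if_pos hM
    nlinarith [tailEnergy_nonneg hh M ht, hh.nonneg hs]
  · have h1 : tailEnergy h M t = t * h t := if_pos (hM.trans_le hts)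
    nlinarith [tailEnergy_nonneg hh M hs, hh.mono hs hts]

/-- A bounded weight reduces the weighted estimate to plain `L¹` convergence; the rest is a sum of
tails. -/
lemma mul_norm_sub_le (hh : IsProfile h) {V : Type*} [NormedAddCommGroup V] {M s : ℝ} (hM : 0 ≤ M)
    (hs : 0 ≤ s) (p q : V) :
    h s * ‖p - q‖ ≤ h M * ‖p - q‖ +
      (2 * tailEnergy h M s + (tailEnergy h M ‖p‖ + tailEnergy h M ‖q‖)) := by
  have t0 := tailEnergy_nonneg hh M hs
  have t1 := tailEnergy_nonneg hh M (norm_nonneg p)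
  have t2 := tailEnergy_nonneg hh M (norm_nonneg q)
  rcases le_or_gt s M with hsM | hsM
  · have := mul_le_mul_of_nonneg_right (hh.mono hs hsM) (norm_nonneg (p - q))
    linarith
  · have h1 := mul_le_add_tailEnergy hh hs (norm_nonneg p) hsM
    have h2 := mul_le_add_tailEnergy hh hs (norm_nonneg q) hsM
    have h3 := mul_le_mul_of_nonneg_left (norm_sub_le p q) (hh.nonneg hs)
    have h4 := mul_nonneg (hh.nonneg hM) (norm_nonneg (p - q))
    linarith

lemma measurable_tailEnergy_norm (hh : IsProfile h) (M : ℝ) :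
    Measurable fun ξ : EuclideanSpace ℝ (Fin n) => tailEnergy h M ‖ξ‖ := by
  unfold tailEnergy
  exact Measurable.ite (measurableSet_lt measurable_const measurable_norm)
    (measurable_norm.mul hh.continuous_norm.measurable) measurable_const

lemma tendsto_lintegral_tailEnergy (hh : IsProfile h) {μ : Measure (EuclideanSpace ℝ (Fin n))}
    {G : EuclideanSpace ℝ (Fin n) → EuclideanSpace ℝ (Fin n)} (hG : AEStronglyMeasurable G μ)
    (hfin : ∫⁻ x, ENNReal.ofReal (‖G x‖ * h ‖G x‖) ∂μ < ⊤) :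
    Tendsto (fun k : ℕ => ∫⁻ x, ENNReal.ofReal (tailEnergy h k ‖G x‖) ∂μ) atTop (𝓝 0) := by
  rw [← lintegral_zero (μ := μ)]
  refine tendsto_lintegral_of_dominated_convergence'
    (fun x => ENNReal.ofReal (‖G x‖ * h ‖G x‖))
    (fun k => ((measurable_tailEnergy_norm hh k).comp_aemeasurable hG.aemeasurable).ennreal_ofReal)
    (fun k => ae_of_all _ fun x => ENNReal.ofReal_le_ofReal ?_) hfin.ne
    (ae_of_all _ fun x => ?_)
  · unfold tailEnergy
    split_ifs
    · exact le_rfl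
    · exact hh.mul_nonneg (norm_nonneg _)
  · refine tendsto_const_nhds.congr' ?_
    filter_upwards [eventually_ge_atTop ⌈‖G x‖⌉₊] with k hk
    have : ¬ ((k : ℝ) < ‖G x‖) := not_lt.mpr (Nat.ceil_le.mp hk)
    simp [tailEnergy, this]

/-- Continuity of translations in the energy class, tested against the flux. -/
lemma tendsto_setLIntegral_profile_mul_translate_sub (hh : IsProfile h)
    {S : Set (EuclideanSpace ℝ (Fin n))}
    {G Q : EuclideanSpace ℝ (Fin n) → EuclideanSpace ℝ (Fin n)}
    (hG : AEStronglyMeasurable G (volume.restrict S))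
    (hGfin : ∫⁻ x in S, ENNReal.ofReal (‖G x‖ * h ‖G x‖) < ⊤)
    (hQ : Integrable Q) (hQfin : ∫⁻ x, ENNReal.ofReal (‖Q x‖ * h ‖Q x‖) < ⊤) :
    Tendsto (fun ξ => ∫⁻ y in S, ENNReal.ofReal (h ‖G y‖) * ‖Q (y - ξ) - Q y‖ₑ) (𝓝 0) (𝓝 0) := by
  have hbound : ∀ (k : ℕ) (ξ : EuclideanSpace ℝ (Fin n)),
      ∫⁻ y in S, ENNReal.ofReal (h ‖G y‖) * ‖Q (y - ξ) - Q y‖ₑ ≤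
        ENNReal.ofReal (h k) * (∫⁻ y, ‖Q (y - ξ) - Q y‖ₑ) +
          (2 * (∫⁻ x in S, ENNReal.ofReal (tailEnergy h k ‖G x‖)) +
            2 * (∫⁻ x, ENNReal.ofReal (tailEnergy h k ‖Q x‖))) := by
    intro k ξ
    have hQξ : AEStronglyMeasurable (fun y => Q (y - ξ)) volume :=
      hQ.1.comp_measurePreserving (measurePreserving_sub_right volume ξ)
    have m1 : AEMeasurable (fun y => ENNReal.ofReal (h k) * ‖Q (y - ξ) - Q y‖ₑ)
        (volume.restrict S) := ((hQξ.sub hQ.1).enorm.const_mul _).restrict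
    have m2 : AEMeasurable (fun y => 2 * ENNReal.ofReal (tailEnergy h k ‖G y‖))
        (volume.restrict S) :=
      ((measurable_tailEnergy_norm hh k).comp_aemeasurable hG.aemeasurable).ennreal_ofReal.const_mul _
    have m3 : AEMeasurable (fun y => ENNReal.ofReal (tailEnergy h k ‖Q (y - ξ)‖)) volume :=
      ((measurable_tailEnergy_norm hh k).comp_aemeasurable hQξ.aemeasurable).ennreal_ofReal
    calc ∫⁻ y in S, ENNReal.ofReal (h ‖G y‖) * ‖Q (y - ξ) - Q y‖ₑ
        ≤ ∫⁻ y in S, (ENNReal.ofReal (h k) * ‖Q (y - ξ) - Q y‖ₑ +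
          (2 * ENNReal.ofReal (tailEnergy h k ‖G y‖) +
            (ENNReal.ofReal (tailEnergy h k ‖Q (y - ξ)‖) +
              ENNReal.ofReal (tailEnergy h k ‖Q y‖)))) := by
          refine lintegral_mono fun y => ?_
          have t0 := tailEnergy_nonneg hh k (norm_nonneg (G y))
          have t1 := tailEnergy_nonneg hh k (norm_nonneg (Q (y - ξ)))
          have t2 := tailEnergy_nonneg hh k (norm_nonneg (Q y))
          have e2 : 2 * ENNReal.ofReal (tailEnergy h k ‖G y‖) =
              ENNReal.ofReal (2 * tailEnergy h k ‖G y‖) := by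
            rw [ENNReal.ofReal_mul zero_le_two, ENNReal.ofReal_ofNat]
          have hk := hh.nonneg (Nat.cast_nonneg (α := ℝ) k)
          rw [← ofReal_norm, ← ENNReal.ofReal_mul (hh.nonneg (norm_nonneg _)),
            ← ENNReal.ofReal_mul hk, ← ENNReal.ofReal_add t1 t2,
            e2,
            ← ENNReal.ofReal_add (mul_nonneg zero_le_two t0) (add_nonneg t1 t2),
            ← ENNReal.ofReal_add (mul_nonneg hk (norm_nonneg _))
              (add_nonneg (mul_nonneg zero_le_two t0) (add_nonneg t1 t2))]
          exact ENNReal.ofReal_le_ofReal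
            (mul_norm_sub_le hh (Nat.cast_nonneg k) (norm_nonneg _) _ _)
      _ = ENNReal.ofReal (h k) * (∫⁻ y in S, ‖Q (y - ξ) - Q y‖ₑ) +
          (2 * (∫⁻ x in S, ENNReal.ofReal (tailEnergy h k ‖G x‖)) +
            ((∫⁻ x in S, ENNReal.ofReal (tailEnergy h k ‖Q (x - ξ)‖)) +
            (∫⁻ x in S, ENNReal.ofReal (tailEnergy h k ‖Q x‖)))) := by
          rw [lintegral_add_left' m1, lintegral_add_left' m2, lintegral_add_left' m3.restrict,
            lintegral_const_mul' _ _ ENNReal.ofReal_ne_top,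
            lintegral_const_mul' _ _ ENNReal.ofNat_ne_top]
      _ ≤ ENNReal.ofReal (h k) * (∫⁻ y, ‖Q (y - ξ) - Q y‖ₑ) +
          (2 * (∫⁻ x in S, ENNReal.ofReal (tailEnergy h k ‖G x‖)) +
            ((∫⁻ x, ENNReal.ofReal (tailEnergy h k ‖Q (x - ξ)‖)) +
            (∫⁻ x, ENNReal.ofReal (tailEnergy h k ‖Q x‖)))) := by
          gcongr <;> exact Measure.restrict_le_self
      _ = _ := by
          -- Translation invariance makes the tail of the shifted field independent of `ξ`, so the
          -- error is uniform in the shift.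
          rw [lintegral_sub_right_eq_self
            (fun y => ENNReal.ofReal (tailEnergy h k ‖Q y‖)) ξ, ← two_mul]
  rw [ENNReal.tendsto_nhds_zero]
  intro ε hε
  have htail : Tendsto (fun k : ℕ => 2 * (∫⁻ x in S, ENNReal.ofReal (tailEnergy h k ‖G x‖)) +
      2 * (∫⁻ x, ENNReal.ofReal (tailEnergy h k ‖Q x‖))) atTop (𝓝 0) := by
    have a1 := ENNReal.Tendsto.const_mul (a := 2) (tendsto_lintegral_tailEnergy hh hG hGfin)
      (Or.inr ENNReal.ofNat_ne_top)
    have a2 := ENNReal.Tendsto.const_mul (a := 2) (tendsto_lintegral_tailEnergy hh hQ.1 hQfin)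
      (Or.inr ENNReal.ofNat_ne_top)
    simpa using a1.add a2
  have hε2 : 0 < ε / 2 := ENNReal.half_pos hε.ne'
  -- The level `k` is fixed first, making the tails small for all shifts; only then is `ξ` sent to
  -- `0`.
  obtain ⟨k, hk⟩ := (ENNReal.tendsto_nhds_zero.mp htail (ε / 2) hε2).exists
  have hmain : Tendsto (fun ξ => ENNReal.ofReal (h k) * (∫⁻ y, ‖Q (y - ξ) - Q y‖ₑ)) (𝓝 0) (𝓝 0) := by
    have := ENNReal.Tendsto.const_mul (a := ENNReal.ofReal (h k))
      (tendsto_lintegral_enorm_translate_sub hQ) (Or.inr ENNReal.ofReal_ne_top)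
    rwa [mul_zero] at this
  filter_upwards [ENNReal.tendsto_nhds_zero.mp hmain (ε / 2) hε2] with ξ hξ
  calc _ ≤ _ := hbound k ξ
    _ ≤ ε / 2 + ε / 2 := add_le_add hξ hk
    _ = ε := ENNReal.add_halves ε

end TranslationEstimate

/-! ### Mollification and inward shifting. -/

section Mollification

variable {D : Set (EuclideanSpace ℝ (Fin n))} {F f : EuclideanSpace ℝ (Fin n) → ℝ}
  {Q G : EuclideanSpace ℝ (Fin n) → EuclideanSpace ℝ (Fin n)}

/-- Product rule: multiplication by a smooth function. -/
lemma HasZeroExtension.smooth_mul (hf : HasZeroExtension D f G)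
    {ζ : EuclideanSpace ℝ (Fin n) → ℝ} (hζ : ContDiff ℝ ∞ ζ) :
    HasZeroExtension D (fun x => ζ x * f x) (fun x => f x • gradient ζ x + ζ x • G x) := by
  intro ψ hψ hψc a
  rw [← hf (fun x => ζ x * ψ x) (hζ.mul hψ) hψc.mul_left a]
  congr 1
  funext x
  have h1 : HasFDerivAt (fun x => ζ x * ψ x) _ x :=
    (hζ.differentiable (by simp) x).hasFDerivAt.mul (hψ.differentiable (by simp) x).hasFDerivAt
  rw [h1.fderiv, inner_add_left, real_inner_smul_left, real_inner_smul_left, inner_gradient_left]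
  simp only [add_apply, smul_apply, smul_eq_mul]
  ring

/-- The gradient of a mollification. -/
lemma HasZeroExtension.gradient_convolution (hD : IsOpen D) (hFQ : HasZeroExtension D F Q)
    (hF : IntegrableOn F D) (hQ : IntegrableOn Q D)
    {ρ : EuclideanSpace ℝ (Fin n) → ℝ} (hρ : ContDiff ℝ ∞ ρ) (hρc : HasCompactSupport ρ)
    (y : EuclideanSpace ℝ (Fin n)) :
    gradient (convolution ρ (D.indicator F) (ContinuousLinearMap.lsmul ℝ ℝ) volume) y =
      ∫ ξ, ρ ξ • D.indicator Q (y - ξ) := by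
  have hρ1 : ContDiff ℝ 1 ρ := hρ.of_le (by exact_mod_cast le_top)
  have hFi : Integrable (D.indicator F) := (integrable_indicator_iff hD.measurableSet).mpr hF
  have hQi : Integrable (D.indicator Q) := (integrable_indicator_iff hD.measurableSet).mpr hQ
  obtain ⟨C, hC⟩ := hρc.exists_bound_of_continuous hρ.continuous
  refine ext_inner_right ℝ fun a => ?_
  have hdc : Continuous fun t => fderiv ℝ ρ t a :=
    (hρ1.continuous_fderiv one_ne_zero).clm_apply continuous_const
  obtain ⟨C', hC'⟩ := (hρc.fderiv_apply ℝ a).exists_bound_of_continuous hdc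
  have hrefl : Continuous fun t : EuclideanSpace ℝ (Fin n) => y - t := by fun_prop
  have i1 : IntegrableOn (fun t => F t * fderiv ℝ ρ (y - t) a) D :=
    Integrable.mul_bdd (c := C') hF (hdc.comp hrefl).aestronglyMeasurable
      (ae_of_all _ fun t => hC' _)
  have i2 : IntegrableOn (fun t => inner ℝ (Q t) a * ρ (y - t)) D :=
    Integrable.mul_bdd (c := C) (Integrable.inner_const hQ a)
      (hρ.continuous.comp hrefl).aestronglyMeasurable (ae_of_all _ fun t => hC _)
  have hL : inner ℝ (gradient (convolution ρ (D.indicator F) (ContinuousLinearMap.lsmul ℝ ℝ) volume) y) a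
      = ∫ t in D, F t * fderiv ℝ ρ (y - t) a := by
    rw [inner_gradient_left, (hρc.hasFDerivAt_convolution_left (ContinuousLinearMap.lsmul ℝ ℝ) hρ1
      hFi.locallyIntegrable y).fderiv]
    have hex := (hρc.fderiv (𝕜 := ℝ)).convolutionExists_left
      (ContinuousLinearMap.precompL (EuclideanSpace ℝ (Fin n)) (ContinuousLinearMap.lsmul ℝ ℝ))
      (hρ1.continuous_fderiv one_ne_zero) hFi.locallyIntegrable y
    rw [convolution, ContinuousLinearMap.integral_apply hex,
      ← integral_sub_left_eq_self _ volume y, ← integral_indicator hD.measurableSet]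
    congr 1
    funext t
    rw [sub_sub_cancel, ContinuousLinearMap.precompL_apply]
    by_cases ht : t ∈ D
    · simp [ht, mul_comm]
    · simp [ht]
  have hR : inner ℝ (∫ ξ, ρ ξ • D.indicator Q (y - ξ)) a =
      ∫ t in D, inner ℝ (Q t) a * ρ (y - t) := by
    have hi : Integrable fun ξ => ρ ξ • D.indicator Q (y - ξ) :=
      Integrable.bdd_smul (C := C) (hQi.comp_sub_left y) hρ.continuous.aestronglyMeasurable
        (ae_of_all _ hC)
    rw [real_inner_comm, ← integral_inner hi, ← integral_sub_left_eq_self _ volume y,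
      ← integral_indicator hD.measurableSet]
    congr 1
    funext t
    rw [sub_sub_cancel, inner_smul_right, real_inner_comm]
    by_cases ht : t ∈ D
    · simp [ht, mul_comm]
    · simp [ht]
  rw [hL, hR]
  -- The zero-extension identity is tested with the reflected kernel `t ↦ ρ (y - t)`; reflection
  -- reverses the sign of the derivative.
  have hψ : ContDiff ℝ ∞ fun t => ρ (y - t) := hρ.comp (contDiff_const.sub contDiff_id)
  have hψc : HasCompactSupport fun t => ρ (y - t) :=
    hρc.comp_homeomorph (Homeomorph.subLeft y)
  have key := hFQ _ hψ hψc a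
  have hder : ∀ t, fderiv ℝ (fun t => ρ (y - t)) t a = -fderiv ℝ ρ (y - t) a := by
    intro t
    have h1 : HasFDerivAt (fun t : EuclideanSpace ℝ (Fin n) => y - t)
        (-ContinuousLinearMap.id ℝ (EuclideanSpace ℝ (Fin n))) t :=
      (hasFDerivAt_id t).const_sub y
    have h2 := ((hρ1.differentiable one_ne_zero (y - t)).hasFDerivAt).comp t h1
    have h3 : HasFDerivAt (fun t => ρ (y - t)) _ t := h2
    rw [h3.fderiv]
    simp
  simp_rw [hder, mul_neg] at key
  have i1' : IntegrableOn (fun t => -(F t * fderiv ℝ ρ (y - t) a)) D := i1.neg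
  rw [integral_add i1' i2, integral_neg] at key
  linarith

/-- Moving the closure of `D` by small vectors of the cone moves it into `D`. -/
lemma add_mem_of_cone {x e : EuclideanSpace ℝ (Fin n)} {r κ : ℝ} (hκ : 0 < κ)
    (hcone : ∀ ξ, ‖ξ - e‖ < κ → IsUpwardIn D x r ξ) {τ : ℝ} (hτ : 0 < τ)
    {k b : EuclideanSpace ℝ (Fin n)} (hk : k ∈ closure D) (hkr : k ∈ Metric.ball x r)
    (hb : ‖b - τ • e‖ ≤ τ * (κ / 2)) (hkb : k + b ∈ Metric.ball x r) : k + b ∈ D := by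
  obtain ⟨δ, hδ, hδb⟩ := Metric.isOpen_iff.mp Metric.isOpen_ball k hkr
  -- Half of the aperture goes to the spread of `b`, the other half to replacing `k` in the closure
  -- by a nearby point `k'` of `D`.
  obtain ⟨k', hk'D, hk'⟩ := Metric.mem_closure_iff.mp hk (min δ (τ * (κ / 2)))
    (lt_min hδ (by positivity))
  have hk'r : k' ∈ Metric.ball x r := hδb (by
    rw [Metric.mem_ball, dist_comm]; exact hk'.trans_le (min_le_left _ _))
  have hkk : ‖k - k'‖ < τ * (κ / 2) := by
    rw [← dist_eq_norm]; exact hk'.trans_le (min_le_right _ _)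
  have heq : k' + τ • (τ⁻¹ • (b + (k - k'))) = k + b := by
    rw [smul_smul, mul_inv_cancel₀ hτ.ne', one_smul]
    abel
  have hdir : ‖τ⁻¹ • (b + (k - k')) - e‖ < κ := by
    have h1 : τ⁻¹ • (b + (k - k')) - e = τ⁻¹ • ((b - τ • e) + (k - k')) := by
      have : τ⁻¹ • τ • e = e := by rw [smul_smul, inv_mul_cancel₀ hτ.ne', one_smul]
      rw [show b - τ • e + (k - k') = b + (k - k') - τ • e by abel,
        smul_sub τ⁻¹ (b + (k - k')), this]
    rw [h1, norm_smul, norm_inv, Real.norm_of_nonneg hτ.le, inv_mul_lt_iff₀ hτ]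
    have := norm_add_le (b - τ • e) (k - k')
    linarith
  have := hcone _ hdir k' hk'D hk'r τ hτ (by rwa [heq])
  rwa [heq] at this

/-- Mollification with a kernel supported in the cone produces test functions in `D`. -/
lemma isTestFunction_convolution (hD : IsOpen D) {K : Set (EuclideanSpace ℝ (Fin n))}
    (hK : IsCompact K) (hFK : ∀ y, y ∉ K → F y = 0) (hF : IntegrableOn F D)
    {ρ : EuclideanSpace ℝ (Fin n) → ℝ} (hρ : ContDiff ℝ ∞ ρ) {B : Set (EuclideanSpace ℝ (Fin n))}
    (hB : IsCompact B) (hρB : Function.support ρ ⊆ B)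
    (hBK : ∀ k ∈ closure D, k ∈ K → ∀ b ∈ B, k + b ∈ D) :
    IsTestFunction D (convolution ρ (D.indicator F) (ContinuousLinearMap.lsmul ℝ ℝ) volume) := by
  have hFi : Integrable (D.indicator F) := (integrable_indicator_iff hD.measurableSet).mpr hF
  have hρc : HasCompactSupport ρ := HasCompactSupport.of_support_subset_isCompact hB hρB
  let N : Set (EuclideanSpace ℝ (Fin n)) := (fun p => p.1 + p.2) '' (B ×ˢ (closure D ∩ K))
  have hN : IsCompact N := (hB.prod (hK.inter_left isClosed_closure)).image continuous_add
  have hsupp : Function.support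
      (convolution ρ (D.indicator F) (ContinuousLinearMap.lsmul ℝ ℝ) volume) ⊆ N := by
    refine (support_convolution_subset _).trans ?_
    rintro _ ⟨b, hb, k, hk, rfl⟩
    refine ⟨(b, k), ⟨hρB hb, ?_, ?_⟩, rfl⟩
    · exact subset_closure (by_contra fun hkD => hk (indicator_of_notMem hkD F))
    · by_contra hkK
      refine hk ?_
      simp [indicator, hFK k hkK]
  refine ⟨hρc.contDiff_convolution_left _ hρ hFi.locallyIntegrable,
    HasCompactSupport.of_support_subset_isCompact hN hsupp,
    (closure_minimal hsupp hN.isClosed).trans ?_⟩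
  rintro _ ⟨⟨b, k⟩, ⟨hb, hk, hkK⟩, rfl⟩
  change b + k ∈ D
  rw [add_comm]
  exact hBK k hk hkK b hb

end Mollification

/-! ### Admitting nonsmooth test functions near a point. -/

section Admissible

variable {D : Set (EuclideanSpace ℝ (Fin n))}

/-- A mollification is close to the original function, in a weighted `L¹` sense, as soon as the
translations in the support of the kernel are. -/
lemma setLIntegral_mollification_sub_le
    {Q : EuclideanSpace ℝ (Fin n) → EuclideanSpace ℝ (Fin n)} (hQ : Integrable Q)
    {ρ : EuclideanSpace ℝ (Fin n) → ℝ} (hρ : Continuous ρ) (hρc : HasCompactSupport ρ)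
    (hρ0 : ∀ x, 0 ≤ ρ x) (hρ1 : ∫ x, ρ x = 1) {g : EuclideanSpace ℝ (Fin n) → ENNReal}
    (hg : AEMeasurable g (volume.restrict D)) {U : Set (EuclideanSpace ℝ (Fin n))} {ε : ENNReal}
    (hU : Function.support ρ ⊆ U)
    (hε : ∀ ξ ∈ U, ∫⁻ y in D, g y * ‖Q (y - ξ) - Q y‖ₑ ≤ ε) :
    ∫⁻ y in D, g y * ‖(∫ ξ, ρ ξ • Q (y - ξ)) - Q y‖ₑ ≤ ε := by
  obtain ⟨C, hC⟩ := hρc.exists_bound_of_continuous hρ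
  have hρi : Integrable ρ := hρ.integrable_of_hasCompactSupport hρc
  have hρe : ∫⁻ ξ, ‖ρ ξ‖ₑ = 1 := by
    rw [← ofReal_integral_norm_eq_lintegral_enorm hρi]
    simp_rw [Real.norm_of_nonneg (hρ0 _), hρ1, ENNReal.ofReal_one]
  have hpt : ∀ y, ‖(∫ ξ, ρ ξ • Q (y - ξ)) - Q y‖ₑ ≤ ∫⁻ ξ, ‖ρ ξ‖ₑ * ‖Q (y - ξ) - Q y‖ₑ := by
    intro y
    have h1 : Q y = ∫ ξ, ρ ξ • Q y := by rw [integral_smul_const, hρ1, one_smul]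
    have h2 : Integrable fun ξ => ρ ξ • Q (y - ξ) :=
      Integrable.bdd_smul (C := C) (hQ.comp_sub_left y) hρ.aestronglyMeasurable (ae_of_all _ hC)
    nth_rewrite 1 [h1]
    rw [← integral_sub h2 (hρi.smul_const _)]
    refine (enorm_integral_le_lintegral_enorm _).trans (le_of_eq ?_)
    congr 1
    funext ξ
    rw [← smul_sub, enorm_smul]
  have hmeas : AEMeasurable (Function.uncurry fun y ξ => g y * (‖ρ ξ‖ₑ * ‖Q (y - ξ) - Q y‖ₑ))
      ((volume.restrict D).prod volume) := by
    have hac : (volume.restrict D).prod (volume : Measure (EuclideanSpace ℝ (Fin n))) ≪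
        volume.prod volume :=
      Measure.AbsolutelyContinuous.prod Measure.absolutelyContinuous_restrict
        Measure.AbsolutelyContinuous.rfl
    have m1 : AEStronglyMeasurable
        (fun p : EuclideanSpace ℝ (Fin n) × EuclideanSpace ℝ (Fin n) => Q (p.1 - p.2))
        (volume.prod volume) :=
      hQ.1.comp_quasiMeasurePreserving
        (quasiMeasurePreserving_sub_of_right_invariant volume volume)
    have m2 : AEStronglyMeasurable
        (fun p : EuclideanSpace ℝ (Fin n) × EuclideanSpace ℝ (Fin n) => Q p.1)
        (volume.prod volume) := hQ.1.comp_fst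
    have m3 : AEMeasurable
        (fun p : EuclideanSpace ℝ (Fin n) × EuclideanSpace ℝ (Fin n) => g p.1)
        ((volume.restrict D).prod volume) := hg.comp_fst
    have m4 : Measurable
        (fun p : EuclideanSpace ℝ (Fin n) × EuclideanSpace ℝ (Fin n) => ‖ρ p.2‖ₑ) :=
      (hρ.measurable.comp measurable_snd).enorm
    exact m3.mul (m4.aemeasurable.mul ((m1.sub m2).mono_ac hac).enorm)
  -- Swapping the integrals exhibits the error as an average of the translation errors over the
  -- kernel.
  calc ∫⁻ y in D, g y * ‖(∫ ξ, ρ ξ • Q (y - ξ)) - Q y‖ₑ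
      ≤ ∫⁻ y in D, ∫⁻ ξ, g y * (‖ρ ξ‖ₑ * ‖Q (y - ξ) - Q y‖ₑ) := by
        refine lintegral_mono fun y => (mul_le_mul_right (hpt y) _).trans ?_
        exact lintegral_const_mul_le _ _
    _ = ∫⁻ ξ, ∫⁻ y in D, g y * (‖ρ ξ‖ₑ * ‖Q (y - ξ) - Q y‖ₑ) := lintegral_lintegral_swap hmeas
    _ ≤ ∫⁻ ξ, ‖ρ ξ‖ₑ * ε := by
        refine lintegral_mono fun ξ => ?_
        have h1 : ∀ y, g y * (‖ρ ξ‖ₑ * ‖Q (y - ξ) - Q y‖ₑ) =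
            ‖ρ ξ‖ₑ * (g y * ‖Q (y - ξ) - Q y‖ₑ) := fun y => mul_left_comm _ _ _
        simp_rw [h1]
        rw [lintegral_const_mul' _ _ enorm_ne_top]
        by_cases hξ : ξ ∈ U
        · exact mul_le_mul_right (hε ξ hξ) _
        · have : ρ ξ = 0 := by_contra fun h => hξ (hU h)
          simp [this]
    _ = ε := by rw [lintegral_mul_const _ hρ.measurable.enorm, hρe, one_mul]

variable {h : ℝ → ℝ} {F : EuclideanSpace ℝ (Fin n) → ℝ}
  {A Q G : EuclideanSpace ℝ (Fin n) → EuclideanSpace ℝ (Fin n)}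

/-- The mixed product `h(|G|)|Q|` is bounded by the two diagonal energies, with no dual Orlicz
space. -/
lemma integrableOn_inner_of_energy (hh : IsProfile h)
    (hA : AEStronglyMeasurable A (volume.restrict D)) (hAG : ∀ x, ‖A x‖ ≤ h ‖G x‖)
    (hGm : AEStronglyMeasurable G (volume.restrict D))
    (hQm : AEStronglyMeasurable Q (volume.restrict D))
    {S : Set (EuclideanSpace ℝ (Fin n))} (hD : MeasurableSet D) (hSD : S ⊆ D)
    (hQS : ∀ x ∈ D, x ∉ S → Q x = 0)
    (hGfin : ∫⁻ x in S, ENNReal.ofReal (‖G x‖ * h ‖G x‖) < ⊤)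
    (hQfin : ∫⁻ x in S, ENNReal.ofReal (‖Q x‖ * h ‖Q x‖) < ⊤) :
    IntegrableOn (fun x => inner ℝ (A x) (Q x)) D := by
  have hS : IntegrableOn (fun x => inner ℝ (A x) (Q x)) S := by
    refine ⟨(hA.inner hQm).mono_measure (Measure.restrict_mono hSD le_rfl), ?_⟩
    have hm : AEMeasurable (fun x => ENNReal.ofReal (‖G x‖ * h ‖G x‖)) (volume.restrict S) :=
      ((continuous_norm.mul hh.continuous_norm).comp_aestronglyMeasurable
        (hGm.mono_measure (Measure.restrict_mono hSD le_rfl))).aemeasurable.ennreal_ofReal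
    refine lt_of_le_of_lt ?_ (ENNReal.add_lt_top.mpr ⟨hGfin, hQfin⟩)
    rw [← lintegral_add_left' hm]
    refine lintegral_mono fun x => ?_
    rw [← ofReal_norm, ← ENNReal.ofReal_add (hh.mul_nonneg (norm_nonneg _))
      (hh.mul_nonneg (norm_nonneg _))]
    refine ENNReal.ofReal_le_ofReal ((norm_inner_le_norm _ _).trans ?_)
    exact (mul_le_mul_of_nonneg_right (hAG x) (norm_nonneg _)).trans
      (hh.mul_le_add (norm_nonneg _) (norm_nonneg _))
  refine hS.of_forall_sdiff_eq_zero hD fun x hx => ?_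
  rw [hQS x hx.1 hx.2, inner_zero_right]

/-- Weak inequalities extend from smooth test functions to functions that are supported in a small
ball and extend by zero. -/
lemma setIntegral_inner_nonpos_of_cone (hh : IsProfile h) (hD : IsOpen D)
    (hA : AEStronglyMeasurable A (volume.restrict D)) (hAG : ∀ x, ‖A x‖ ≤ h ‖G x‖)
    (hGm : AEStronglyMeasurable G (volume.restrict D)) (hG : HasFiniteEnergy h D G)
    (hAφ : ∀ φ, IsTestFunction D φ → (∀ x, 0 ≤ φ x) →
      ∫ x in D, inner ℝ (A x) (gradient φ x) ≤ 0)
    {x e : EuclideanSpace ℝ (Fin n)} {r κ : ℝ} (hκ : 0 < κ)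
    (hcone : ∀ ξ, ‖ξ - e‖ < κ → IsUpwardIn D x r ξ)
    {K : Set (EuclideanSpace ℝ (Fin n))} (hK : IsCompact K) (hKr : K ⊆ Metric.ball x r)
    (hFQ : HasZeroExtension D F Q) (hF : IntegrableOn F D) (hF0 : ∀ y, 0 ≤ F y)
    (hQm : AEStronglyMeasurable Q (volume.restrict D)) (hQ : HasFiniteEnergy h D Q)
    (hFK : ∀ y, y ∉ K → F y = 0) (hQK : ∀ y, y ∉ K → Q y = 0) :
    ∫ y in D, inner ℝ (A y) (Q y) ≤ 0 := by
  obtain ⟨R, hR⟩ := hK.isBounded.subset_ball (0 : EuclideanSpace ℝ (Fin n))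
  -- The extra radius `1` leaves room for translating the support of `Q` by vectors shorter than
  -- `1`.
  set S := D ∩ Metric.ball (0 : EuclideanSpace ℝ (Fin n)) (R + 1) with hS
  have hSD : S ⊆ D := inter_subset_left
  have hSm : MeasurableSet S := (hD.inter Metric.isOpen_ball).measurableSet
  have hSfin : volume S < ⊤ := measure_inter_ball_lt_top D _
  have hKS : ∀ y, y ∉ Metric.ball (0 : EuclideanSpace ℝ (Fin n)) (R + 1) → ∀ ξ, ‖ξ‖ < 1 →
      y - ξ ∉ K := by
    intro y hy ξ hξ hyK
    have h1 := hR hyK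
    rw [Metric.mem_ball, dist_zero_right] at h1 hy
    have h2 := norm_sub_norm_le y ξ
    linarith
  have hQS : ∀ y ∈ D, y ∉ S → Q y = 0 := fun y hy hyS =>
    hQK y fun hyK => hyS ⟨hy, Metric.ball_subset_ball (by linarith) (hR hyK)⟩
  have hQSi : IntegrableOn Q S := hQ.integrableOn_ball hh hQm (R + 1)
  have hQi : IntegrableOn Q D := hQSi.of_forall_sdiff_eq_zero hD.measurableSet fun y hy =>
    hQS y hy.1 hy.2
  have hGfin := hG.lintegral_lt_top hSD hSfin
  have hQfin := hQ.lintegral_lt_top hSD hSfin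
  have hAQ : IntegrableOn (fun x => inner ℝ (A x) (Q x)) D :=
    integrableOn_inner_of_energy hh hA hAG hGm hQm hD.measurableSet hSD hQS hGfin hQfin
  have hQbi : Integrable (D.indicator Q) := (integrable_indicator_iff hD.measurableSet).mpr hQi
  have hQbfin : ∫⁻ y, ENNReal.ofReal (‖D.indicator Q y‖ * h ‖D.indicator Q y‖) < ⊤ := by
    refine lt_of_le_of_lt ?_ hQfin
    rw [← lintegral_indicator hSm]
    refine lintegral_mono fun y => ?_
    by_cases hyD : y ∈ D
    · by_cases hyS : y ∈ S
      · simp [hyD, hyS]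
      · simp [hyD, hyS, hQS y hyD hyS]
    · simp [hyD]
  have htrans := tendsto_setLIntegral_profile_mul_translate_sub hh
    (hGm.mono_measure (Measure.restrict_mono hSD le_rfl)) hGfin hQbi hQbfin
  refine le_of_forall_pos_le_add fun ε hε => ?_
  rw [zero_add]
  have hε' : 0 < ENNReal.ofReal ε := ENNReal.ofReal_pos.mpr hε
  obtain ⟨δ₁, hδ₁, hb₁⟩ := Metric.eventually_nhds_iff.mp
    (ENNReal.tendsto_nhds_zero.mp htrans _ hε')
  obtain ⟨δ₂, hδ₂, hb₂⟩ := hK.exists_thickening_subset_open Metric.isOpen_ball hKr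
  -- All shifts in the kernel must be shorter than `δ₁` (translation error below `ε`), `δ₂` (the
  -- shifted support stays in the ball of the cone condition) and `1` (it stays over `S`).
  obtain ⟨τ, hτ, hτb⟩ : ∃ τ > 0, τ * (‖e‖ + κ) < min (min δ₁ δ₂) 1 := by
    have hm : 0 < min (min δ₁ δ₂) 1 := lt_min (lt_min hδ₁ hδ₂) one_pos
    refine ⟨min (min δ₁ δ₂) 1 / (2 * (‖e‖ + κ)), by positivity, ?_⟩
    have : 0 < ‖e‖ + κ := by positivity
    rw [div_mul_eq_mul_div, div_lt_iff₀ (by positivity)]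
    nlinarith
  -- The kernel is centred at `τ • e` rather than at the origin, so mollification also shifts
  -- inward; the radius `τκ/2` keeps it inside the cone.
  let bump : ContDiffBump (τ • e) :=
    ⟨τ * (κ / 4), τ * (κ / 2), by positivity, by nlinarith [mul_pos hτ hκ]⟩
  let ρ : EuclideanSpace ℝ (Fin n) → ℝ := bump.normed volume
  have hρs : Function.support ρ ⊆ Metric.closedBall (τ • e) (τ * (κ / 2)) := by
    rw [show Function.support ρ = _ from bump.support_normed_eq]
    exact Metric.ball_subset_closedBall
  have hsmall : ∀ ξ ∈ Metric.closedBall (τ • e) (τ * (κ / 2)), ‖ξ‖ < min (min δ₁ δ₂) 1 := by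
    intro ξ hξ
    rw [mem_closedBall_iff_norm] at hξ
    have h1 : ‖ξ‖ ≤ ‖ξ - τ • e‖ + ‖τ • e‖ := by simpa using norm_add_le (ξ - τ • e) (τ • e)
    rw [norm_smul, Real.norm_of_nonneg hτ.le] at h1
    nlinarith [mul_pos hτ hκ]
  have hρ : ContDiff ℝ ∞ ρ := bump.contDiff_normed
  have hρc : HasCompactSupport ρ := bump.hasCompactSupport_normed
  set φ := convolution ρ (D.indicator F) (ContinuousLinearMap.lsmul ℝ ℝ) volume with hφ
  have htest : IsTestFunction D φ := by
    refine isTestFunction_convolution hD hK hFK hF hρ (isCompact_closedBall _ _) hρs ?_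
    intro k hkD hkK b hb
    refine add_mem_of_cone hκ hcone hτ hkD (hKr hkK) (by rwa [← mem_closedBall_iff_norm]) ?_
    refine hb₂ (Metric.mem_thickening_iff.mpr ⟨k, hkK, ?_⟩)
    rw [dist_eq_norm, add_sub_cancel_left]
    exact (hsmall b hb).trans_le ((min_le_left _ _).trans (min_le_right _ _))
  have hφ0 : ∀ y, 0 ≤ φ y := fun y =>
    integral_nonneg fun t => mul_nonneg (bump.nonneg_normed t)
      (indicator_nonneg (fun z _ => hF0 z) _)
  have hgrad : ∀ y, gradient φ y = ∫ ξ, ρ ξ • D.indicator Q (y - ξ) :=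
    hFQ.gradient_convolution hD hF hQi hρ hρc
  have hm : AEMeasurable (fun y => ENNReal.ofReal (h ‖G y‖)) (volume.restrict D) :=
    (hh.continuous_norm.comp_aestronglyMeasurable hGm).aemeasurable.ennreal_ofReal
  have hest := setLIntegral_mollification_sub_le hQbi hρ.continuous hρc
    (fun x => bump.nonneg_normed x) bump.integral_normed hm (ε := ENNReal.ofReal ε) hρs (by
      intro ξ hξ
      have hξs := hsmall ξ hξ
      refine le_trans ?_ (hb₁ (y := ξ) (by
        rw [dist_zero_right]
        exact hξs.trans_le ((min_le_left _ _).trans (min_le_left _ _))))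
      rw [← lintegral_indicator hD.measurableSet, ← lintegral_indicator hSm]
      refine lintegral_mono fun y => ?_
      by_cases hyD : y ∈ D
      · by_cases hyS : y ∈ S
        · rw [indicator_of_mem hyD, indicator_of_mem hyS]
        · have hyb : y ∉ Metric.ball (0 : EuclideanSpace ℝ (Fin n)) (R + 1) := fun hyb =>
            hyS ⟨hyD, hyb⟩
          have h1 : D.indicator Q (y - ξ) = 0 := by
            simp [indicator, hQK _ (hKS y hyb ξ (hξs.trans_le (min_le_right _ _)))]
          rw [indicator_of_mem hyD, h1, indicator_of_mem hyD, hQS y hyD hyS]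
          simp
      · rw [indicator_of_notMem hyD]
        exact zero_le)
  have hgm : AEStronglyMeasurable (gradient φ) (volume.restrict D) :=
    (continuous_gradient (htest.contDiff.of_le (by exact_mod_cast le_top))).aestronglyMeasurable
  have hdiffle : ∫⁻ y in D, ‖inner ℝ (A y) (gradient φ y - Q y)‖ₑ ≤ ENNReal.ofReal ε := by
    refine le_trans ?_ hest
    refine setLIntegral_mono' hD.measurableSet fun y hy => ?_
    rw [← hgrad, indicator_of_mem hy, ← ofReal_norm, ← ofReal_norm,
      ← ENNReal.ofReal_mul (hh.nonneg (norm_nonneg _))]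
    exact ENNReal.ofReal_le_ofReal ((norm_inner_le_norm _ _).trans
      (mul_le_mul_of_nonneg_right (hAG y) (norm_nonneg _)))
  have hdiff : IntegrableOn (fun y => inner ℝ (A y) (gradient φ y - Q y)) D :=
    ⟨hA.inner (hgm.sub hQm), hdiffle.trans_lt ENNReal.ofReal_lt_top⟩
  have hφint := hAφ φ htest hφ0
  have hsplit : ∫ y in D, inner ℝ (A y) (gradient φ y) =
      (∫ y in D, inner ℝ (A y) (gradient φ y - Q y)) + ∫ y in D, inner ℝ (A y) (Q y) := by
    rw [← integral_add hdiff hAQ]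
    congr 1
    funext y
    rw [inner_sub_right, sub_add_cancel]
  have habs : |∫ y in D, inner ℝ (A y) (gradient φ y - Q y)| ≤ ε := by
    have h1 := (enorm_integral_le_lintegral_enorm
      (μ := volume.restrict D) fun y => inner ℝ (A y) (gradient φ y - Q y)).trans hdiffle
    rw [← ofReal_norm, ENNReal.ofReal_le_ofReal_iff hε.le] at h1
    exact h1
  linarith [(abs_le.mp habs).1]

end Admissible

/-! ### Gluing the local inequalities, and vanishing of gradient-free extensions. -/

section Globalization

variable {D : Set (EuclideanSpace ℝ (Fin n))} {h : ℝ → ℝ} {f : EuclideanSpace ℝ (Fin n) → ℝ}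
  {A G Gf : EuclideanSpace ℝ (Fin n) → EuclideanSpace ℝ (Fin n)}

lemma gradient_eq_zero_of_notMem_tsupport {ζ : EuclideanSpace ℝ (Fin n) → ℝ}
    {x : EuclideanSpace ℝ (Fin n)} (hx : x ∉ tsupport ζ) : gradient ζ x = 0 := by
  have : fderiv ℝ ζ x = 0 := by_contra fun h => hx (support_fderiv_subset ℝ h)
  simp [gradient, this]

lemma norm_gradient (ζ : EuclideanSpace ℝ (Fin n) → ℝ) (x : EuclideanSpace ℝ (Fin n)) :
    ‖gradient ζ x‖ = ‖fderiv ℝ ζ x‖ :=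
  LinearIsometryEquiv.norm_map _ _

/-- Finite energy of the gradient of the product with a smooth function. -/
lemma HasFiniteEnergy.smooth_mul (hh : IsProfile h) (hGf : HasFiniteEnergy h D Gf)
    (hGfm : AEStronglyMeasurable Gf (volume.restrict D)) (hf : ∀ x, |f x| ≤ 1)
    {ζ : EuclideanSpace ℝ (Fin n) → ℝ} (hζ : ContDiff ℝ ∞ ζ) (hζc : HasCompactSupport ζ) :
    HasFiniteEnergy h D (fun x => f x • gradient ζ x + ζ x • Gf x) := by
  have hζ1 : ContDiff ℝ 1 ζ := hζ.of_le (by exact_mod_cast le_top)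
  obtain ⟨C, hC⟩ := hζc.exists_bound_of_continuous hζ.continuous
  obtain ⟨C', hC'⟩ := (hζc.fderiv (𝕜 := ℝ)).exists_bound_of_continuous
    (hζ1.continuous_fderiv one_ne_zero)
  have hC0 : 0 ≤ C := (norm_nonneg _).trans (hC 0)
  have hC'0 : 0 ≤ C' := (norm_nonneg _).trans (hC' 0)
  refine HasFiniteEnergy.of_norm_le hh hGf hGf hGfm hC'0 hC0 fun x => ?_
  calc ‖f x • gradient ζ x + ζ x • Gf x‖ ≤ ‖f x • gradient ζ x‖ + ‖ζ x • Gf x‖ := norm_add_le _ _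
    _ = |f x| * ‖fderiv ℝ ζ x‖ + ‖ζ x‖ * ‖Gf x‖ := by
        rw [norm_smul, norm_smul, norm_gradient, Real.norm_eq_abs (f x)]
    _ ≤ 1 * C' + C * ‖Gf x‖ := by
        gcongr
        · exact hf x
        · exact hC' x
        · exact hC x
    _ ≤ C' + C * ‖Gf x‖ + C * ‖Gf x‖ := by
        have := mul_nonneg hC0 (norm_nonneg (Gf x))
        linarith

lemma integrableOn_inner_of_compact (hh : IsProfile h) (hD : IsOpen D)
    (hA : AEStronglyMeasurable A (volume.restrict D)) (hAG : ∀ x, ‖A x‖ ≤ h ‖G x‖)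
    (hGm : AEStronglyMeasurable G (volume.restrict D)) (hG : HasFiniteEnergy h D G)
    {Q : EuclideanSpace ℝ (Fin n) → EuclideanSpace ℝ (Fin n)}
    (hQm : AEStronglyMeasurable Q (volume.restrict D)) (hQ : HasFiniteEnergy h D Q)
    {K : Set (EuclideanSpace ℝ (Fin n))} (hK : IsCompact K) (hQK : ∀ y, y ∉ K → Q y = 0) :
    IntegrableOn (fun x => inner ℝ (A x) (Q x)) D := by
  obtain ⟨R, hR⟩ := hK.isBounded.subset_ball (0 : EuclideanSpace ℝ (Fin n))
  exact integrableOn_inner_of_energy hh hA hAG hGm hQm hD.measurableSet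
    (inter_subset_left (t := Metric.ball 0 R))
    (fun x hx hxS => hQK x fun hxK => hxS ⟨hx, hR hxK⟩)
    (hG.lintegral_lt_top inter_subset_left (measure_inter_ball_lt_top D R))
    (hQ.lintegral_lt_top inter_subset_left (measure_inter_ball_lt_top D R))

/-- Weak inequalities in a `C¹` domain extend from smooth test functions to cut-offs of bounded
nonnegative functions of finite energy that extend by zero. -/
lemma setIntegral_inner_nonpos_of_hasZeroExtension (hh : IsProfile h) (hD : IsOpen D)
    (hD1 : HasC1Boundary D)
    (hA : AEStronglyMeasurable A (volume.restrict D)) (hAG : ∀ x, ‖A x‖ ≤ h ‖G x‖)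
    (hGm : AEStronglyMeasurable G (volume.restrict D)) (hG : HasFiniteEnergy h D G)
    (hAφ : ∀ φ, IsTestFunction D φ → (∀ x, 0 ≤ φ x) →
      ∫ x in D, inner ℝ (A x) (gradient φ x) ≤ 0)
    (hfG : HasZeroExtension D f Gf) (hfm : AEStronglyMeasurable f (volume.restrict D))
    (hf0 : ∀ x, 0 ≤ f x) (hf1 : ∀ x, |f x| ≤ 1)
    (hGfm : AEStronglyMeasurable Gf (volume.restrict D)) (hGf : HasFiniteEnergy h D Gf)
    {η : EuclideanSpace ℝ (Fin n) → ℝ} (hη : ContDiff ℝ ∞ η) (hηc : HasCompactSupport η)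
    (hη0 : ∀ x, 0 ≤ η x) :
    ∫ x in D, inner ℝ (A x) (f x • gradient η x + η x • Gf x) ≤ 0 := by
  -- The test function is split by a partition of unity into pieces, each living in one ball with
  -- its own cone. Nonnegativity of the partition keeps the pieces admissible for a sub-solution.
  choose r hr e κ hκ hcone using hD1.exists_cone hD
  obtain ⟨t, χ, hχ, hχs, hχ0, hχ1⟩ := exists_smooth_partition hηc.isCompact hr
  have hζ : ∀ i, ContDiff ℝ ∞ fun x => χ i x * η x := fun i => (hχ i).mul hη
  have hζc : ∀ i, HasCompactSupport fun x => χ i x * η x := fun i => hηc.mul_left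
  have hQm : ∀ ζ : EuclideanSpace ℝ (Fin n) → ℝ, ContDiff ℝ ∞ ζ →
      AEStronglyMeasurable (fun x => f x • gradient ζ x + ζ x • Gf x) (volume.restrict D) :=
    fun ζ hζ => (hfm.smul (continuous_gradient
      (hζ.of_le (by exact_mod_cast le_top))).aestronglyMeasurable).add
      (hζ.continuous.aestronglyMeasurable.smul hGfm)
  have hQK : ∀ ζ : EuclideanSpace ℝ (Fin n) → ℝ, ∀ y, y ∉ tsupport ζ →
      f y • gradient ζ y + ζ y • Gf y = 0 := fun ζ y hy => by
    rw [gradient_eq_zero_of_notMem_tsupport hy, image_eq_zero_of_notMem_tsupport hy, smul_zero,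
      zero_smul, add_zero]
  have hloc : ∀ i, ∫ x in D, inner ℝ (A x) (f x • gradient (fun x => χ i x * η x) x +
      (χ i x * η x) • Gf x) ≤ 0 := by
    intro i
    refine setIntegral_inner_nonpos_of_cone hh hD hA hAG hGm hG hAφ (hκ i) (hcone i) (hζc i)
      ((tsupport_mul_subset_left (f := χ i) (g := η)).trans (hχs i))
      (hfG.smooth_mul (hζ i)) ?_ (fun y => mul_nonneg (mul_nonneg (hχ0 i y) (hη0 y)) (hf0 y))
      (hQm _ (hζ i)) (hGf.smooth_mul hh hGfm hf1 (hζ i) (hζc i)) (fun y hy => ?_)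
      (hQK _)
    · exact ((hζ i).continuous.integrable_of_hasCompactSupport (hζc i)).restrict.mul_bdd (c := 1)
        hfm (ae_of_all _ hf1)
    · rw [image_eq_zero_of_notMem_tsupport hy, zero_mul]
  have hint : ∀ i, IntegrableOn (fun x => inner ℝ (A x)
      (f x • gradient (fun x => χ i x * η x) x + (χ i x * η x) • Gf x)) D := fun i =>
    integrableOn_inner_of_compact hh hD hA hAG hGm hG (hQm _ (hζ i))
      (hGf.smooth_mul hh hGfm hf1 (hζ i) (hζc i)) (hζc i) (hQK _)
  have hsum : ∀ x, ∑ i, χ i x * η x = η x := by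
    intro x
    rw [← Finset.sum_mul]
    by_cases hx : x ∈ tsupport η
    · rw [hχ1 x hx, one_mul]
    · rw [image_eq_zero_of_notMem_tsupport hx, mul_zero]
  have hgsum : ∀ x, ∑ i, gradient (fun x => χ i x * η x) x = gradient η x := by
    intro x
    unfold gradient
    rw [← map_sum, ← fderiv_fun_sum fun i _ => (hζ i).differentiable (by simp) x]
    simp_rw [hsum]
  have htot : ∫ x in D, inner ℝ (A x) (f x • gradient η x + η x • Gf x) =
      ∑ i, ∫ x in D, inner ℝ (A x) (f x • gradient (fun x => χ i x * η x) x +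
        (χ i x * η x) • Gf x) := by
    rw [← integral_finsetSum _ fun i _ => hint i]
    congr 1
    funext x
    rw [← inner_sum, Finset.sum_add_distrib, ← Finset.smul_sum, ← Finset.sum_smul, hsum, hgsum]
  rw [htot]
  exact Finset.sum_nonpos fun i _ => hloc i

/-- An integrable function whose extension by zero has vanishing gradient vanishes. -/
lemma HasZeroExtension.ae_eq_zero (hn : n ≠ 0) (hD : IsOpen D)
    (hf : HasZeroExtension D f fun _ => 0) (hfi : IntegrableOn f D) :
    ∀ᵐ x ∂(volume.restrict D), f x = 0 := by
  have : Nonempty (Fin n) := ⟨⟨0, Nat.pos_of_ne_zero hn⟩⟩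
  have : NoncompactSpace (EuclideanSpace ℝ (Fin n)) := NormedSpace.noncompactSpace ℝ _
  have hFi : Integrable (D.indicator f) := (integrable_indicator_iff hD.measurableSet).mpr hfi
  let b : ℕ → ContDiffBump (0 : EuclideanSpace ℝ (Fin n)) := fun k =>
    ⟨1 / ((k : ℝ) + 1), 2 * (1 / ((k : ℝ) + 1)), by positivity, by
      have : 0 < 1 / ((k : ℝ) + 1) := by positivity
      linarith⟩
  have hlim : Tendsto (fun k => (b k).rOut) atTop (𝓝 0) := by
    have := (tendsto_one_div_add_atTop_nhds_zero_nat (𝕜 := ℝ)).const_mul 2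
    rwa [mul_zero] at this
  have hconv := ContDiffBump.ae_convolution_tendsto_right_of_locallyIntegrable
    (φ := b) (K := 2) hlim (Eventually.of_forall fun k => le_rfl)
    hFi.locallyIntegrable
  have hzero : ∀ k x, convolution ((b k).normed volume) (D.indicator f)
      (ContinuousLinearMap.lsmul ℝ ℝ) volume x = 0 := by
    intro k
    have hρ : ContDiff ℝ ∞ ((b k).normed volume) := (b k).contDiff_normed
    have hρc := (b k).hasCompactSupport_normed (μ := (volume : Measure (EuclideanSpace ℝ (Fin n))))
    set φ := convolution ((b k).normed volume) (D.indicator f)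
      (ContinuousLinearMap.lsmul ℝ ℝ) volume with hφ
    have hφs : ContDiff ℝ ∞ φ := hρc.contDiff_convolution_left _ hρ hFi.locallyIntegrable
    have hder : ∀ y, fderiv ℝ φ y = 0 := by
      intro y
      have hg := hf.gradient_convolution hD hfi integrableOn_zero hρ hρc y
      simp only [indicator_zero, smul_zero, integral_zero] at hg
      rw [← norm_eq_zero, ← norm_gradient, hg, norm_zero]
    have hφi : Integrable φ :=
      Integrable.integrable_convolution (ContinuousLinearMap.lsmul ℝ ℝ)
        (b k).integrable_normed hFi
    intro x
    -- The mollification is constant and integrable on a space of infinite volume, hence zero.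
    have hc : φ = fun _ => φ x := funext fun y =>
      is_const_of_fderiv_eq_zero (hφs.differentiable (by simp)) hder y x
    rw [hc, integrable_const_iff] at hφi
    refine hφi.resolve_right fun hfin => ?_
    have := hfin.measure_univ_lt_top
    rw [measure_univ_of_isAddLeftInvariant] at this
    exact lt_irrefl _ this
  rw [ae_restrict_iff' hD.measurableSet]
  filter_upwards [hconv] with x hx hxD
  simp_rw [hzero] at hx
  have := tendsto_nhds_unique hx tendsto_const_nhds
  rwa [indicator_of_mem hxD] at this

end Globalization

/-! ### Truncations and cut-offs. -/

section Truncation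

/-- A smooth truncation that is positive exactly above the level `ε`. -/
lemma exists_isTruncation {ε : ℝ} (hε : 0 < ε) :
    ∃ β L, IsTruncation β L ∧ (∀ s ≤ ε, β s = 0) ∧ ∀ s > ε, 0 < β s := by
  let β : ℝ → ℝ := fun s => Real.smoothTransition (s - ε)
  have hβ : ContDiff ℝ 1 β :=
    (Real.smoothTransition.contDiff (n := 1)).comp (contDiff_id.sub contDiff_const)
  have hmono : Monotone β := fun s t hst => Real.smoothTransition.monotone (sub_le_sub_right hst ε)
  have hcont : Continuous (deriv β) := hβ.continuous_deriv le_rfl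
  have hzero : ∀ s, s ∉ Icc ε (ε + 1) → deriv β s = 0 := by
    intro s hs
    rcases lt_or_ge s ε with h1 | h1
    · have : β =ᶠ[𝓝 s] fun _ => 0 := by
        filter_upwards [Iio_mem_nhds h1] with t ht
        exact Real.smoothTransition.zero_of_nonpos (sub_nonpos.mpr (le_of_lt ht))
      rw [this.deriv_eq, deriv_const]
    · have h2 : ε + 1 < s := by
        by_contra hcon
        exact hs ⟨h1, not_lt.mp hcon⟩
      have : β =ᶠ[𝓝 s] fun _ => 1 := by
        filter_upwards [Ioi_mem_nhds h2] with t ht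
        refine Real.smoothTransition.one_of_one_le ?_
        have : ε + 1 < t := ht
        linarith
      rw [this.deriv_eq, deriv_const]
  obtain ⟨L, hL⟩ := (HasCompactSupport.intro isCompact_Icc hzero).exists_bound_of_continuous hcont
  refine ⟨β, L, ⟨hβ, fun s => Real.smoothTransition.nonneg _, fun s => Real.smoothTransition.le_one _,
    fun s => hmono.deriv_nonneg, fun s => (le_abs_self _).trans (hL s), fun s hs => ?_⟩,
    fun s hs => ?_, fun s hs => ?_⟩
  · exact Real.smoothTransition.zero_of_nonpos (by linarith)
  · exact Real.smoothTransition.zero_of_nonpos (by linarith)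
  · exact Real.smoothTransition.pos_of_pos (sub_pos.mpr hs)

/-- Cut-off functions with gradient of order `1 / R`. -/
lemma exists_cutoff (n : ℕ) : ∃ C : ℝ, 0 ≤ C ∧ ∀ R > 0, ∃ η : EuclideanSpace ℝ (Fin n) → ℝ,
    ContDiff ℝ ∞ η ∧ HasCompactSupport η ∧ (∀ x, 0 ≤ η x) ∧ (∀ x ∈ Metric.ball 0 R, η x = 1) ∧
      ∀ x, ‖gradient η x‖ ≤ C / R := by
  let b : ContDiffBump (0 : EuclideanSpace ℝ (Fin n)) := ⟨1, 2, one_pos, one_lt_two⟩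
  have hb : ContDiff ℝ ∞ b := b.contDiff
  obtain ⟨C, hC⟩ := (b.hasCompactSupport.fderiv (𝕜 := ℝ)).exists_bound_of_continuous
    (hb.continuous_fderiv (by simp))
  refine ⟨C, (norm_nonneg _).trans (hC 0), fun R hR => ⟨fun x => b (R⁻¹ • x), ?_, ?_, ?_, ?_, ?_⟩⟩
  · exact hb.comp (contDiff_const_smul _)
  · exact b.hasCompactSupport.comp_smul (inv_ne_zero hR.ne')
  · exact fun x => b.nonneg
  · intro x hx
    refine b.one_of_mem_closedBall ?_
    rw [mem_ball_zero_iff] at hx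
    rw [mem_closedBall_zero_iff, norm_smul, norm_inv, Real.norm_of_nonneg hR.le]
    change R⁻¹ * ‖x‖ ≤ 1
    rw [inv_mul_le_iff₀ hR, mul_one]
    exact hx.le
  · intro x
    have h1 : HasFDerivAt (fun x : EuclideanSpace ℝ (Fin n) => R⁻¹ • x)
        (R⁻¹ • ContinuousLinearMap.id ℝ (EuclideanSpace ℝ (Fin n))) x :=
      (hasFDerivAt_id x).const_smul R⁻¹
    have h2 : HasFDerivAt (fun x => b (R⁻¹ • x)) _ x :=
      ((hb.differentiable (by simp) (R⁻¹ • x)).hasFDerivAt).comp x h1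
    rw [norm_gradient, h2.fderiv, ContinuousLinearMap.comp_smul, ContinuousLinearMap.comp_id,
      norm_smul, norm_inv, Real.norm_of_nonneg hR.le, inv_mul_eq_div]
    exact div_le_div_of_nonneg_right (hC _) hR.le

end Truncation

/-! ### The energy estimate and the comparison argument. -/

section Comparison

variable {D : Set (EuclideanSpace ℝ (Fin n))} {h : ℝ → ℝ} {u v : EuclideanSpace ℝ (Fin n) → ℝ}
  {Gu Gv : EuclideanSpace ℝ (Fin n) → EuclideanSpace ℝ (Fin n)}

/-- The energy estimate for truncations of `v - u`: the monotonicity term vanishes. -/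
lemma ae_deriv_smul_sub_eq_zero (hh : IsProfile h) (hD : IsOpen D) (hD1 : HasC1Boundary D)
    (hum : AEStronglyMeasurable u (volume.restrict D))
    (hvm : AEStronglyMeasurable v (volume.restrict D))
    (hGum : AEStronglyMeasurable Gu (volume.restrict D))
    (hGvm : AEStronglyMeasurable Gv (volume.restrict D))
    (hGu : HasFiniteEnergy h D Gu) (hGv : HasFiniteEnergy h D Gv)
    (hu : IsWeakSolution h D Gu) (hv : IsWeakSubsolution h D Gv)
    {β : ℝ → ℝ} {L : ℝ} (hβ : IsTruncation β L) {ε : ℝ} (hβε : ∀ s ≤ ε, β s = 0)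
    (hfin : volume.restrict D {x | ε ≤ v x - u x} < ⊤)
    (hext : HasZeroExtension D (fun x => β (v x - u x))
      (fun x => deriv β (v x - u x) • (Gv x - Gu x))) :
    ∀ᵐ x ∂(volume.restrict D), deriv β (v x - u x) • (Gv x - Gu x) = 0 := by
  set f : EuclideanSpace ℝ (Fin n) → ℝ := fun x => β (v x - u x) with hf
  set Gf : EuclideanSpace ℝ (Fin n) → EuclideanSpace ℝ (Fin n) :=
    fun x => deriv β (v x - u x) • (Gv x - Gu x) with hGf
  have hwm : AEStronglyMeasurable (fun x => v x - u x) (volume.restrict D) := hvm.sub hum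
  have hfm : AEStronglyMeasurable f (volume.restrict D) :=
    hβ.contDiff.continuous.comp_aestronglyMeasurable hwm
  have hGfm : AEStronglyMeasurable Gf (volume.restrict D) :=
    (hβ.continuous_deriv.comp_aestronglyMeasurable hwm).smul (hGvm.sub hGum)
  have hGfe : HasFiniteEnergy h D Gf := by
    refine HasFiniteEnergy.of_norm_le hh hGv hGu hGvm le_rfl hβ.bound_nonneg fun x => ?_
    rw [zero_add, hGf, norm_smul, ← mul_add]
    exact mul_le_mul (hβ.abs_deriv_le _) (norm_sub_le _ _) (norm_nonneg _) hβ.bound_nonneg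
  have hAvm : AEStronglyMeasurable (fun x => flux h (Gv x)) (volume.restrict D) :=
    ((measurable_flux hh).comp_aemeasurable hGvm.aemeasurable).aestronglyMeasurable
  have hAum : AEStronglyMeasurable (fun x => flux h (Gu x)) (volume.restrict D) :=
    ((measurable_flux hh).comp_aemeasurable hGum.aemeasurable).aestronglyMeasurable
  -- the superlevel set of `v - u`
  obtain ⟨S, hSm, hSD, hSfin, hSf⟩ : ∃ S, MeasurableSet S ∧ S ⊆ D ∧ volume S < ⊤ ∧
      ∀ᵐ x ∂(volume.restrict D), x ∉ S → f x = 0 := by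
    refine ⟨toMeasurable (volume.restrict D) {x | ε ≤ v x - u x} ∩ D,
      (measurableSet_toMeasurable _ _).inter hD.measurableSet, inter_subset_right, ?_, ?_⟩
    · rw [← Measure.restrict_apply (measurableSet_toMeasurable _ _), measure_toMeasurable]
      exact hfin
    · filter_upwards [ae_restrict_mem hD.measurableSet] with x hxD hxS
      refine hβε _ (le_of_not_ge fun hge => hxS ⟨subset_toMeasurable _ _ hge, hxD⟩)
  -- `N` does not depend on the cut-off radius, so the error `(C / R) * N` vanishes in the limit.
  let N : ENNReal := (∫⁻ x in S, ENNReal.ofReal (h ‖Gv x‖)) + ∫⁻ x in S, ENNReal.ofReal (h ‖Gu x‖)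
  have hN : N < ⊤ := ENNReal.add_lt_top.mpr
    ⟨hGv.lintegral_profile_lt_top hh hSD hSfin, hGu.lintegral_profile_lt_top hh hSD hSfin⟩
  let P : EuclideanSpace ℝ (Fin n) → ℝ := fun x =>
    inner ℝ (flux h (Gv x) - flux h (Gu x)) (Gf x)
  have hP0 : ∀ x, 0 ≤ P x := fun x => by
    simp only [P, hGf, inner_smul_right]
    exact mul_nonneg (hβ.deriv_nonneg _) (inner_flux_sub_nonneg hh _ _)
  obtain ⟨C, hC0, hcut⟩ := exists_cutoff n
  have hest : ∀ R > 0, ∫⁻ x in D ∩ Metric.ball 0 R, ENNReal.ofReal (P x) ≤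
      ENNReal.ofReal (C / R) * N := by
    intro R hR
    obtain ⟨η, hη, hηc, hη0, hη1, hηg⟩ := hcut R hR
    have hηgm : AEStronglyMeasurable (gradient η) (volume.restrict D) :=
      (continuous_gradient (hη.of_le (by exact_mod_cast le_top))).aestronglyMeasurable
    have hf1 : ∀ x, |f x| ≤ 1 := fun x => hβ.abs_le _
    have hQm : AEStronglyMeasurable (fun x => f x • gradient η x + η x • Gf x)
        (volume.restrict D) :=
      (hfm.smul hηgm).add (hη.continuous.aestronglyMeasurable.smul hGfm)
    have hQe := hGfe.smooth_mul hh hGfm hf1 hη hηc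
    have hQK : ∀ y, y ∉ tsupport η → f y • gradient η y + η y • Gf y = 0 := fun y hy => by
      rw [gradient_eq_zero_of_notMem_tsupport hy, image_eq_zero_of_notMem_tsupport hy, smul_zero,
        zero_smul, add_zero]
    have hv' := setIntegral_inner_nonpos_of_hasZeroExtension hh hD hD1 hAvm
      (fun x => (norm_flux hh (Gv x)).le) hGvm hGv hv hext hfm (fun x => hβ.nonneg _) hf1 hGfm
      hGfe hη hηc hη0
    -- For the solution the weak relation is an equality, so it may also be used with the flux
    -- negated; adding it to the relation for `v` produces the flux difference.
    have hu' := setIntegral_inner_nonpos_of_hasZeroExtension (A := fun x => -flux h (Gu x)) hh hD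
      hD1 hAum.neg (fun x => by rw [norm_neg, norm_flux hh]) hGum hGu
      (fun φ hφ _ => by simp_rw [inner_neg_left, integral_neg, hu φ hφ, neg_zero]; exact le_rfl)
      hext hfm (fun x => hβ.nonneg _) hf1 hGfm hGfe hη hηc hη0
    have iv := integrableOn_inner_of_compact hh hD hAvm (fun x => (norm_flux hh (Gv x)).le) hGvm
      hGv hQm hQe hηc hQK
    have iu := integrableOn_inner_of_compact (A := fun x => -flux h (Gu x)) hh hD hAum.neg
      (fun x => by rw [norm_neg, norm_flux hh]) hGum hGu hQm hQe hηc hQK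
    -- the two parts of the tested inequality
    have hgbound : ∀ᵐ x ∂(volume.restrict D),
        ‖inner ℝ (flux h (Gv x) - flux h (Gu x)) (f x • gradient η x)‖ₑ ≤
          S.indicator (fun x => ENNReal.ofReal (C / R) *
            (ENNReal.ofReal (h ‖Gv x‖) + ENNReal.ofReal (h ‖Gu x‖))) x := by
      filter_upwards [hSf] with x hx
      by_cases hxS : x ∈ S
      · rw [indicator_of_mem hxS, ← ENNReal.ofReal_add (hh.nonneg (norm_nonneg _))
          (hh.nonneg (norm_nonneg _)), ← ENNReal.ofReal_mul (by positivity), ← ofReal_norm]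
        refine ENNReal.ofReal_le_ofReal ((norm_inner_le_norm _ _).trans ?_)
        rw [norm_smul, mul_comm]
        refine mul_le_mul ?_ ?_ (norm_nonneg _) (by positivity)
        · calc ‖f x‖ * ‖gradient η x‖ ≤ 1 * (C / R) :=
                mul_le_mul (hf1 x) (hηg x) (norm_nonneg _) zero_le_one
            _ = C / R := one_mul _
        · rw [← norm_flux hh, ← norm_flux hh]
          exact norm_sub_le _ _
      · rw [hx hxS, zero_smul, inner_zero_right, enorm_zero]
        exact zero_le
    have hgle : ∫⁻ x in D, ‖inner ℝ (flux h (Gv x) - flux h (Gu x)) (f x • gradient η x)‖ₑ ≤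
        ENNReal.ofReal (C / R) * N := by
      refine (lintegral_mono_ae hgbound).trans ?_
      rw [lintegral_indicator hSm, Measure.restrict_restrict hSm, inter_eq_left.mpr hSD,
        lintegral_const_mul' _ _ ENNReal.ofReal_ne_top, lintegral_add_left']
      exact ((hh.continuous_norm.comp_aestronglyMeasurable
        (hGvm.mono_measure (Measure.restrict_mono hSD le_rfl))).aemeasurable).ennreal_ofReal
    have hgi : IntegrableOn
        (fun x => inner ℝ (flux h (Gv x) - flux h (Gu x)) (f x • gradient η x)) D :=
      ⟨(hAvm.sub hAum).inner (hfm.smul hηgm),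
        hgle.trans_lt (ENNReal.mul_lt_top ENNReal.ofReal_lt_top hN)⟩
    -- The tested expression splits into `η P` and the `∇η` term; integrability of `η P` follows by
    -- subtraction.
    have hPi : IntegrableOn (fun x => η x * P x) D := by
      refine ((iv.add iu).sub hgi).congr (ae_of_all _ fun x => ?_)
      simp only [P, Pi.sub_apply, Pi.add_apply, inner_add_right, inner_smul_right, inner_neg_left,
        inner_sub_left]
      ring
    have hsum : ∫ x in D, η x * P x ≤
        -∫ x in D, inner ℝ (flux h (Gv x) - flux h (Gu x)) (f x • gradient η x) := by
      have h1 : (∫ x in D, η x * P x) +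
          ∫ x in D, inner ℝ (flux h (Gv x) - flux h (Gu x)) (f x • gradient η x) =
          (∫ x in D, inner ℝ (flux h (Gv x)) (f x • gradient η x + η x • Gf x)) +
          ∫ x in D, inner ℝ (-flux h (Gu x)) (f x • gradient η x + η x • Gf x) := by
        rw [← integral_add hPi hgi, ← integral_add iv iu]
        congr 1
        funext x
        simp only [P, inner_add_right, inner_smul_right, inner_neg_left, inner_sub_left]
        ring
      linarith
    calc ∫⁻ x in D ∩ Metric.ball 0 R, ENNReal.ofReal (P x)
        ≤ ∫⁻ x in D, ENNReal.ofReal (η x * P x) := by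
          rw [← lintegral_indicator hD.measurableSet,
            ← lintegral_indicator (hD.inter Metric.isOpen_ball).measurableSet]
          refine lintegral_mono fun x => ?_
          by_cases hx : x ∈ D ∩ Metric.ball 0 R
          · rw [indicator_of_mem hx, indicator_of_mem hx.1, hη1 x hx.2, one_mul]
          · rw [indicator_of_notMem hx]
            exact zero_le
      _ = ENNReal.ofReal (∫ x in D, η x * P x) :=
          (ofReal_integral_eq_lintegral_ofReal hPi
            (ae_of_all _ fun x => mul_nonneg (hη0 x) (hP0 x))).symm
      _ ≤ ‖∫ x in D, inner ℝ (flux h (Gv x) - flux h (Gu x)) (f x • gradient η x)‖ₑ := by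
          rw [← ofReal_norm]
          exact ENNReal.ofReal_le_ofReal (hsum.trans (neg_le_abs _))
      _ ≤ ENNReal.ofReal (C / R) * N := (enorm_integral_le_lintegral_enorm _).trans hgle
  have hPzero : ∫⁻ x in D, ENNReal.ofReal (P x) = 0 := by
    have hlim : Tendsto (fun k : ℕ => ENNReal.ofReal (C / ((k : ℝ) + 1)) * N) atTop (𝓝 0) := by
      have h1 : Tendsto (fun k : ℕ => C / ((k : ℝ) + 1)) atTop (𝓝 0) := by
        have := (tendsto_one_div_add_atTop_nhds_zero_nat (𝕜 := ℝ)).const_mul C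
        simpa [div_eq_mul_inv] using this
      have h2 := ENNReal.Tendsto.mul_const (b := N) (ENNReal.tendsto_ofReal h1) (Or.inr hN.ne)
      simpa using h2
    have hball : ∀ m : ℕ, ∫⁻ x in D ∩ Metric.ball 0 (m : ℝ), ENNReal.ofReal (P x) = 0 := by
      intro m
      refine le_antisymm (ge_of_tendsto hlim ?_) zero_le
      filter_upwards [eventually_ge_atTop m] with k hk
      refine le_trans (lintegral_mono_set ?_) (hest ((k : ℝ) + 1) (by positivity))
      refine inter_subset_inter_right _ (Metric.ball_subset_ball ?_)
      have : (m : ℝ) ≤ k := by exact_mod_cast hk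
      linarith
    have hU : D = ⋃ m : ℕ, D ∩ Metric.ball 0 (m : ℝ) := by
      rw [← inter_iUnion, Metric.iUnion_ball_nat, inter_univ]
    rw [hU]
    refine le_antisymm ((lintegral_iUnion_le _ _).trans ?_) zero_le
    simp [hball]
  have hPm : AEMeasurable P (volume.restrict D) :=
    ((hAvm.sub hAum).inner hGfm).aemeasurable
  filter_upwards [(lintegral_eq_zero_iff' hPm.ennreal_ofReal).mp hPzero] with x hx
  have hx0 : P x = 0 := le_antisymm (ENNReal.ofReal_eq_zero.mp hx) (hP0 x)
  simp only [P, hGf, inner_smul_right] at hx0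
  -- Either `β'` vanishes at this point, or strict monotonicity makes the two gradients equal.
  rcases mul_eq_zero.mp hx0 with h1 | h1
  · rw [h1, zero_smul]
  · rw [eq_of_inner_flux_sub_eq_zero hh h1, sub_self, smul_zero]

/-- The comparison principle for functions of finite energy. -/
lemma ae_le_of_hasFiniteEnergy (hn : n ≠ 0) (hh : IsProfile h) (hD : IsOpen D)
    (hD1 : HasC1Boundary D)
    (hum : AEStronglyMeasurable u (volume.restrict D))
    (hvm : AEStronglyMeasurable v (volume.restrict D))
    (hGum : AEStronglyMeasurable Gu (volume.restrict D))
    (hGvm : AEStronglyMeasurable Gv (volume.restrict D))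
    (hGu : HasFiniteEnergy h D Gu) (hGv : HasFiniteEnergy h D Gv)
    (hfin : ∀ ε > 0, volume.restrict D {x | ε ≤ v x - u x} < ⊤)
    (hu : IsWeakSolution h D Gu) (hv : IsWeakSubsolution h D Gv)
    (hvu : TraceLE D v Gv u Gu) :
    ∀ᵐ x ∂(volume.restrict D), v x ≤ u x := by
  have hwm : AEStronglyMeasurable (fun x => v x - u x) (volume.restrict D) := hvm.sub hum
  have hGi : ∀ R, IntegrableOn (fun x => Gv x - Gu x) (D ∩ Metric.ball 0 R) := fun R =>
    (hGv.integrableOn_ball hh hGvm R).sub (hGu.integrableOn_ball hh hGum R)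
  -- Truncating at `ε > 0` rather than at `0` gives the truncation a support of finite measure; this
  -- is used both in the energy estimate and for the integrability of `β(v - u)`.
  have hlevel : ∀ ε > 0, ∀ᵐ x ∂(volume.restrict D), v x - u x ≤ ε := by
    intro ε hε
    obtain ⟨β, L, hβ, hβ0, hβpos⟩ := exists_isTruncation hε
    have hext := (hvu.hasNonposTrace hvm hGvm).hasZeroExtension hn hD hD1 hwm hGi hβ
    have hG0 := ae_deriv_smul_sub_eq_zero hh hD hD1 hum hvm hGum hGvm hGu hGv hu hv hβ hβ0
      (hfin ε hε) hext
    have hext0 : HasZeroExtension D (fun x => β (v x - u x)) fun _ => 0 := by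
      intro ψ hψ hψc a
      rw [← hext ψ hψ hψc a]
      refine integral_congr_ae (hG0.mono fun x hx => ?_)
      simp only [hx]
    have hfi : IntegrableOn (fun x => β (v x - u x)) D := by
      refine ⟨hβ.contDiff.continuous.comp_aestronglyMeasurable hwm, ?_⟩
      refine lt_of_le_of_lt ?_ (hfin ε hε)
      rw [← lintegral_indicator_one₀ (nullMeasurableSet_le aemeasurable_const hwm.aemeasurable)]
      refine lintegral_mono fun x => ?_
      by_cases hx : ε ≤ v x - u x
      · rw [indicator_of_mem (show x ∈ {x | ε ≤ v x - u x} from hx), ← ofReal_norm, Pi.one_apply,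
          ← ENNReal.ofReal_one]
        exact ENNReal.ofReal_le_ofReal (hβ.abs_le _)
      · rw [show (fun x => β (v x - u x)) x = 0 from hβ0 _ (not_le.mp hx).le, enorm_zero]
        exact zero_le
    filter_upwards [hext0.ae_eq_zero hn hD hfi] with x hx
    by_contra hcon
    exact (hβpos _ (not_le.mp hcon)).ne' hx
  have hall : ∀ᵐ x ∂(volume.restrict D), ∀ k : ℕ, v x - u x ≤ 1 / ((k : ℝ) + 1) :=
    ae_all_iff.mpr fun k => hlevel _ (by positivity)
  filter_upwards [hall] with x hx
  exact sub_nonpos.mp (ge_of_tendsto' tendsto_one_div_add_atTop_nhds_zero_nat hx)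

end Comparison

end HComparison

end

theorem mainTheorem2 {n : ℕ} (hn : 2 ≤ n)
    (h : ℝ → ℝ) (hh : HComparison.IsProfile h)
    (D : Set (EuclideanSpace ℝ (Fin n))) (hDo : IsOpen D) (hDc : IsConnected D)
    (hD1 : HComparison.HasC1Boundary D)
    (u v : EuclideanSpace ℝ (Fin n) → ℝ)
    (Gu Gv : EuclideanSpace ℝ (Fin n) → EuclideanSpace ℝ (Fin n))
    (hspace :
      (∃ p : ℝ, 1 < p ∧ HComparison.HasPowerGrowth h p ∧
        HComparison.MemSobolev p D u Gu ∧ HComparison.MemSobolev p D v Gv) ∨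
      (HComparison.IsOrliczCoercive h ∧
        HComparison.MemSobolevOrlicz (HComparison.energy h) D u Gu ∧
        HComparison.MemSobolevOrlicz (HComparison.energy h) D v Gv))
    (hu : HComparison.IsWeakSolution h D Gu)
    (hv : HComparison.IsWeakSubsolution h D Gv)
    (hvu : HComparison.TraceLE D v Gv u Gu) :
    ∀ᵐ x ∂(volume.restrict D), v x ≤ u x := by
  have hn0 : n ≠ 0 := by omega
  -- The two coercivity conditions serve only to supply finite energy and superlevel sets of finite
  -- measure.
  rcases hspace with ⟨p, hp, hg, hus, hvs⟩ | ⟨hc, hus, hvs⟩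
  · exact HComparison.ae_le_of_hasFiniteEnergy hn0 hh hDo hD1 hus.memLp.1 hvs.memLp.1
      hus.memLp_grad.1 hvs.memLp_grad.1 (hus.hasFiniteEnergy hp hg) (hvs.hasFiniteEnergy hp hg)
      (fun ε hε => HComparison.measure_lt_sub_lt_top
        (fun _ hδ => hus.measure_le_norm_lt_top hp hδ)
        (fun _ hδ => hvs.measure_le_norm_lt_top hp hδ) hε) hu hv hvu
  · exact HComparison.ae_le_of_hasFiniteEnergy hn0 hh hDo hD1 hus.memOrlicz.1 hvs.memOrlicz.1
      hus.memOrlicz_grad.1 hvs.memOrlicz_grad.1 (hus.hasFiniteEnergy hh hc.delta2_energy)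
      (hvs.hasFiniteEnergy hh hc.delta2_energy)
      (fun ε hε => HComparison.measure_lt_sub_lt_top
        (fun _ hδ => hus.measure_le_norm_lt_top hh hδ)
        (fun _ hδ => hvs.measure_le_norm_lt_top hh hδ) hε) hu hv hvu
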